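/- **Corollary.** Recall that a countable first-order structure $M$ is the Fraïssé limit of a class $\mathcal C$ of finitely generated structures if every isomorphism between finitely generated substructures of $M$ extends to an automorphism of $M$, and the finitely generated structures embeddable in $M$ are exactly, up to isomorphism, the members of $\mathcal C$; such an $M$ is unique up to isomorphism. Let - $R$ be the random graph (the Fraïssé limit of the class of finite simple graphs), - $\mathbb P$ be the generic poset (the Fraïssé limit of the class of finite posets), - $\Omega$ be the countable universal homogeneous semilattice (the Fraïssé limit of the class of finite semilattices), - $\mathbb D$ be the countable universal homogeneous distributive lattice (the Fraïssé limit of the class of finite distributive lattices, in the signature $\{\wedge,\vee\}$), - $\mathbb A$ be the countable atomless Boolean algebra (countable, with $0\neq 1$ and no atoms), - $V_\infty^{\mathbb F}$ be the vector space of dimension $\aleph_0$ over an arbitrary field $\mathbb F$. Let $S=\operatorname{End}(M)$ be the endomorphism monoid, under composition, of any one of these structures $M$ (the endomorphisms being, respectively, the edge-preserving maps, the order-preserving maps, the semilattice homomorphisms, the lattice homomorphisms, the Boolean algebra homomorphisms, and the linear maps of $M$ into itself). Then: 1. $S$ has the (semigroup) Bergman property: for every set $A\subseteq S$ that generates $S$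 as a semigroup there is an $m\ge 1$ such that $S=\bigcup_{n=1}^m A^n$, where $A^n=\{a_1\cdots a_n : a_1,\dots,a_n\in A\}$. 2. The monoid $\mathcal T_{\aleph_0}$ of all self-maps of a countably infinite set divides $S$, that is, $\mathcal T_{\aleph_0}$ is a homomorphic image of a subsemigroup of $S$. -/

import Mathlib

open CategoryTheory
open scoped Pointwise

universe u

namespace BergmanEnd

/-! ### Semigroup notions -/

/-- `nPow A n` is the set `A ^ n = {a₁ ⋯ aₙ : a₁, …, aₙ ∈ A}` of all `n`-fold products, for `n ≥ 1`
(there are no empty products in a semigroup: `nPow A 0 = ∅`). -/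
def nPow {S : Type*} [Semigroup S] (A : Set S) : ℕ → Set S
  | 0 => ∅
  | 1 => A
  | n + 2 => nPow A (n + 1) * A

/-- `S` is semigroup Cayley bounded with respect to `A`: `S = A ∪ A ^ 2 ∪ ⋯ ∪ A ^ m` for some
`m ≥ 1`. -/
def IsCayleyBounded (S : Type*) [Semigroup S] (A : Set S) : Prop :=
  ∃ m : ℕ, 1 ≤ m ∧ (⋃ n ∈ Set.Icc 1 m, nPow A n) = Set.univ

/-- The (semigroup) Bergman property: `S` is Cayley bounded with respect to each of its
generating sets, where generation is generation as a semigroup. -/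
def HasBergmanProperty (S : Type*) [Semigroup S] : Prop :=
  ∀ A : Set S, Subsemigroup.closure A = ⊤ → IsCayleyBounded S A

/-- `T` divides `S`: `T` is a homomorphic image of a subsemigroup of `S`. -/
def Divides (T S : Type*) [Semigroup T] [Semigroup S] : Prop :=
  ∃ (U : Subsemigroup S) (f : U →ₙ* T), Function.Surjective f

/-! ### Endomorphism monoids (multiplication is composition, `(f * g) x = f (g x)`)

For graphs (`G →g G`), orders (`P →o P`) and modules (`Module.End F V`) Mathlib has these. -/

instance instMonoidInfHomEnd (α : Type*) [SemilatticeInf α] : Monoid (InfHom α α) where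
  mul f g := f.comp g
  one := InfHom.id α
  mul_assoc _ _ _ := rfl
  one_mul _ := rfl
  mul_one _ := rfl

instance instMonoidLatticeHomEnd (α : Type*) [Lattice α] : Monoid (LatticeHom α α) where
  mul f g := f.comp g
  one := LatticeHom.id α
  mul_assoc _ _ _ := rfl
  one_mul _ := rfl
  mul_one _ := rfl

instance instMonoidBoundedLatticeHomEnd (α : Type*) [Lattice α] [BoundedOrder α] :
    Monoid (BoundedLatticeHom α α) where
  mul f g := f.comp g
  one := BoundedLatticeHom.id α
  mul_assoc _ _ _ := rfl
  one_mul _ := rfl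
  mul_one _ := rfl

/-! ### The signatures of semilattices and of lattices -/

/-- The only symbol of the signature of semilattices is a binary operation. -/
inductive SemilatticeFunc : ℕ → Type
  | inf : SemilatticeFunc 2

/-- The signature of semilattices. -/
def semilatticeLang : FirstOrder.Language.{0, 0} := ⟨SemilatticeFunc, fun _ => Empty⟩

/-- The signature of lattices consists of two binary operations. -/
inductive LatticeFunc : ℕ → Type
  | inf : LatticeFunc 2
  | sup : LatticeFunc 2

/-- The signature of lattices (without constants for bounds). -/
def latticeLang : FirstOrder.Language.{0, 0} := ⟨LatticeFunc, fun _ => Empty⟩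

instance instCountableSemilatticeFunctions : Countable (Σ l, semilatticeLang.Functions l) := by
  have h : Function.Injective (fun _ : (Σ l, semilatticeLang.Functions l) => ()) := by
    rintro ⟨_, ⟨⟩⟩ ⟨_, ⟨⟩⟩ _
    rfl
  exact h.countable

instance instCountableLatticeFunctions : Countable (Σ l, latticeLang.Functions l) := by
  have h : Function.Injective (fun x : (Σ l, latticeLang.Functions l) =>
      match x with
      | ⟨_, .inf⟩ => false
      | ⟨_, .sup⟩ => true) := by
    rintro ⟨_, ⟨⟩⟩ ⟨_, ⟨⟩⟩ h <;> first | rfl | cases h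
  exact h.countable

/-- A meet-semilattice as a first-order structure. -/
@[reducible] def semilatticeStructure (M : Type*) [SemilatticeInf M] :
    semilatticeLang.Structure M where
  funMap
    | .inf => fun x => x 0 ⊓ x 1
  RelMap r := r.elim

/-- A lattice as a first-order structure. -/
@[reducible] def latticeStructure (M : Type*) [Lattice M] : latticeLang.Structure M where
  funMap
    | .inf => fun x => x 0 ⊓ x 1
    | .sup => fun x => x 0 ⊔ x 1
  RelMap r := r.elim

/-! ### The Fraïssé classes -/

/-- The class of all finite simple graphs. -/
def finiteGraphs : Set (Bundled.{u} FirstOrder.Language.graph.Structure) :=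
  {N | Finite N ∧ ∃ G : SimpleGraph N, N.str = G.structure}

/-- The class of all finite posets. -/
def finitePosets : Set (Bundled.{u} FirstOrder.Language.order.Structure) :=
  {N | Finite N ∧ ∃ _ : PartialOrder N, N.str = FirstOrder.Language.orderStructure N}

/-- The class of all finite semilattices. -/
def finiteSemilattices : Set (Bundled.{u} semilatticeLang.Structure) :=
  {N | Finite N ∧ ∃ _ : SemilatticeInf N, N.str = semilatticeStructure N}

/-- The class of all finite distributive lattices. -/
def finiteDistribLattices : Set (Bundled.{u} latticeLang.Structure) :=
  {N | Finite N ∧ ∃ _ : DistribLattice N, N.str = latticeStructure N}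

/-! ### The structures -/

/-- `G` is the (countable) random graph, the Fraïssé limit of the finite simple graphs. -/
def IsRandomGraph {V : Type u} [Countable V] (G : SimpleGraph V) : Prop :=
  letI := G.structure
  FirstOrder.Language.IsFraisseLimit finiteGraphs V

/-- `P` is the generic poset, the Fraïssé limit of the finite posets. -/
def IsGenericPoset (P : Type u) [Countable P] [PartialOrder P] : Prop :=
  letI := FirstOrder.Language.orderStructure P
  FirstOrder.Language.IsFraisseLimit finitePosets P

/-- `S` is the countable universal ultrahomogeneous semilattice, the Fraïssé limit of the finite
semilattices. -/
def IsUniversalHomogeneousSemilattice (S : Type u) [Countable S] [SemilatticeInf S] : Prop :=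
  letI := semilatticeStructure S
  FirstOrder.Language.IsFraisseLimit finiteSemilattices S

/-- `D` is the countable universal ultrahomogeneous distributive lattice, the Fraïssé limit of the
finite distributive lattices. -/
def IsUniversalHomogeneousDistribLattice (D : Type u) [Countable D] [DistribLattice D] : Prop :=
  letI := latticeStructure D
  FirstOrder.Language.IsFraisseLimit finiteDistribLattices D

/-- A Boolean algebra is atomless if `0 ≠ 1` and it has no atoms. -/
def IsAtomlessBooleanAlgebra (A : Type u) [BooleanAlgebra A] : Prop :=
  Nontrivial A ∧ ∀ a : A, ¬ IsAtom a

end BergmanEnd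

/-! Everything follows from one property of `S`, `HasJointExtensions`: there are j₀, j₁, … in `S`
such that for every sequence g in `S` a single f satisfies f jₙ = gₙ for all n. Any sequence then
has the form c bⁿ a, with a = j₀, b shifting the jₙ and c sending jₙ to the n-th term. If `S` were
not a bounded union of powers of A, some sequence would need words of more than quadratic length,
while c bⁿ a has a word of length linear in n. Moreover, the elements mapping {jₙ} into itself under
left multiplication form a subsemigroup that induces every self-map of ℕ.

For a vector space, V ≅ ⨁ₙ V and the jₙ are the inclusions of the summands. For the other structures
M (`exists_joint_extensions`), let Z be the set of all sequences of endomorphisms and ιₙ : M → M^Z,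
m ↦ (gₙ m)_g. It suffices to find F : M → M^Z and endomorphisms jₙ with F jₙ = ιₙ, since the
coordinate of F at g is then the required f. The map F and a section of it over the countably many
points ιₙ m are built back and forth from finitely generated pieces. This needs a class K that
contains the finitely generated substructures of M and of its powers, such that M realizes
extensions in K (homogeneity) and homomorphisms to M extend along embeddings in K (injectivity).

Injectivity is proved for graphs by gluing. For posets, semilattices, distributive lattices and
Boolean algebras it comes from duality with the two-element structure `Prop`
(`isInjectiveFor_of_cogenerator`): homomorphisms to `Prop` are up-sets, filters or prime filters,
and they extend and separate points. -/

namespace BergmanEnd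

/-- A sequence in `S` such that every sequence of elements of `S` is obtained from it by left
multiplication with a single element. -/
def HasJointExtensions (S : Type*) [Mul S] : Prop :=
  ∃ j : ℕ → S, ∀ g : ℕ → S, ∃ f : S, ∀ n, f * j n = g n

/-! ### Consequences of joint extensions for a semigroup -/

section Semigroup

variable {S : Type*} [Semigroup S] {A : Set S}

theorem nPow_succ {n : ℕ} (hn : 1 ≤ n) : nPow A (n + 1) = nPow A n * A := by
  obtain ⟨k, rfl⟩ := Nat.exists_eq_add_of_le' hn
  rfl

theorem mul_mem_nPow {m n : ℕ} (hm : 1 ≤ m) (hn : 1 ≤ n) {x y : S} (hx : x ∈ nPow A m)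
    (hy : y ∈ nPow A n) : x * y ∈ nPow A (m + n) := by
  induction n, hn using Nat.le_induction generalizing y with
  | base => rw [nPow_succ hm]; exact Set.mul_mem_mul hx hy
  | succ k hk ih =>
    rw [nPow_succ hk] at hy
    obtain ⟨a, ha, b, hb, rfl⟩ := hy
    rw [← mul_assoc, ← add_assoc, nPow_succ (by omega)]
    exact Set.mul_mem_mul (ih ha) hb

theorem exists_mem_nPow (hA : Subsemigroup.closure A = ⊤) (x : S) :
    ∃ n, 1 ≤ n ∧ x ∈ nPow A n := by
  have hx : x ∈ Subsemigroup.closure A := hA ▸ Subsemigroup.mem_top x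
  induction hx using Subsemigroup.closure_induction with
  | mem x hx => exact ⟨1, le_rfl, hx⟩
  | mul x y _ _ hx hy =>
    obtain ⟨m, hm, hx⟩ := hx
    obtain ⟨n, hn, hy⟩ := hy
    exact ⟨m + n, by omega, mul_mem_nPow hm hn hx hy⟩

end Semigroup

/-- Joint extension is used twice: b is the shift jₙ ↦ jₙ₊₁, so that bⁿ j₀ = jₙ, and c decodes jₙ to
the n-th term. -/
theorem HasJointExtensions.exists_mul_pow_mul {S : Type*} [Monoid S] (h : HasJointExtensions S)
    (f : ℕ → S) : ∃ a b c : S, ∀ n, c * b ^ n * a = f n := by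
  obtain ⟨j, hj⟩ := h
  obtain ⟨c, hc⟩ := hj f
  obtain ⟨b, hb⟩ := hj fun n => j (n + 1)
  refine ⟨j 0, b, c, fun n => ?_⟩
  have : b ^ n * j 0 = j n := by
    induction n with
    | zero => simp
    | succ n ih => rw [pow_succ', mul_assoc, ih, hb]
  rw [mul_assoc, this, hc]

theorem HasJointExtensions.hasBergmanProperty {S : Type*} [Monoid S] (h : HasJointExtensions S) :
    HasBergmanProperty S := by
  intro A hA
  by_contra hne
  -- Any bound growing faster than linearly would do; the `+ 1` keeps the number of powers positive.
  have hlong : ∀ n : ℕ, ∃ s : S, ∀ k ∈ Set.Icc 1 (n * n + 1), s ∉ nPow A k := by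
    intro n
    by_contra! hcon
    refine hne ⟨n * n + 1, by omega, Set.eq_univ_of_forall fun s => ?_⟩
    obtain ⟨k, hk, hs⟩ := hcon s
    exact Set.mem_biUnion hk hs
  choose f hf using hlong
  obtain ⟨a, b, c, habc⟩ := h.exists_mul_pow_mul f
  obtain ⟨p, hp, ha⟩ := exists_mem_nPow hA a
  obtain ⟨q, hq, hb⟩ := exists_mem_nPow hA b
  obtain ⟨r, hr, hc⟩ := exists_mem_nPow hA c
  have hword : ∀ n : ℕ, c * b ^ n * a ∈ nPow A (r + n * q + p) := by
    have hcb : ∀ n : ℕ, c * b ^ n ∈ nPow A (r + n * q) := by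
      intro n
      induction n with
      | zero => simpa using hc
      | succ n ih =>
        rw [pow_succ, ← mul_assoc, Nat.succ_mul, ← add_assoc]
        exact mul_mem_nPow (by omega) hq ih hb
    exact fun n => mul_mem_nPow (by omega) hp (hcb n) ha
  -- For n = p + q + r the word length r + nq + p is at most n² + 1, because n(p + r) ≥ p + r.
  have hn := hword (p + q + r)
  rw [habc] at hn
  exact hf _ _ ⟨by omega, by nlinarith⟩ hn

theorem HasJointExtensions.divides {S : Type*} [Semigroup S] [Nontrivial S]
    (h : HasJointExtensions S) : Divides (Function.End ℕ) S := by
  obtain ⟨j, hj⟩ := h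
  have hinj : Function.Injective j := by
    intro m n hmn
    by_contra hne
    obtain ⟨x, y, hxy⟩ := exists_pair_ne S
    -- If jₘ = jₙ with m ≠ n, no f could send them to different elements.
    obtain ⟨f, hf⟩ := hj fun k => if k = m then x else y
    have hm := hf m
    have hn := hf n
    rw [if_pos rfl] at hm
    rw [if_neg (Ne.symm hne)] at hn
    exact hxy (by rw [← hm, ← hn, hmn])
  -- Since the jₙ are distinct, each f in `U` determines its self-map t of the indices.
  let U : Subsemigroup S :=
    { carrier := {f | ∃ t : ℕ → ℕ, ∀ n, f * j n = j (t n)}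
      mul_mem' := by
        rintro f g ⟨t, ht⟩ ⟨s, hs⟩
        exact ⟨t ∘ s, fun n => by rw [mul_assoc, hs, ht]; rfl⟩ }
  choose t ht using fun f : U => f.2
  refine ⟨U, ⟨t, fun f g => ?_⟩, fun s => ?_⟩
  · funext n
    apply hinj
    rw [← ht, MulMemClass.coe_mul, mul_assoc, ht, ht]
    rfl
  · obtain ⟨f, hf⟩ := hj fun n => j (s n)
    refine ⟨⟨f, s, hf⟩, ?_⟩
    funext n
    apply hinj
    exact (ht ⟨f, s, hf⟩ n).symm.trans (hf n)

theorem bergman_and_divides {S : Type*} [Monoid S] [Nontrivial S] (h : HasJointExtensions S) :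
    HasBergmanProperty S ∧ Divides (Function.End ℕ) S :=
  ⟨h.hasBergmanProperty, h.divides⟩

/-! ### Vector spaces of countably infinite dimension -/

theorem hasJointExtensions_moduleEnd {F V : Type*} [Field F] [AddCommGroup V] [Module F V]
    (hV : Module.rank F V = Cardinal.aleph0) : HasJointExtensions (Module.End F V) := by
  have hrank : Cardinal.lift.{0} (Module.rank F V) = Module.rank F (ℕ →₀ V) := by
    rw [rank_finsupp]; simp [hV]
  obtain ⟨e⟩ : Nonempty (V ≃ₗ[F] (ℕ →₀ V)) :=
    nonempty_linearEquiv_of_lift_rank_eq (by simpa using hrank)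
  refine ⟨fun n => e.symm.toLinearMap ∘ₗ Finsupp.lsingle n, fun g => ?_⟩
  refine ⟨Finsupp.lsum F g ∘ₗ e.toLinearMap, fun n => ?_⟩
  ext v
  simp [Module.End.mul_apply]

theorem nontrivial_moduleEnd {F V : Type*} [Field F] [AddCommGroup V] [Module F V]
    (hV : Module.rank F V = Cardinal.aleph0) : Nontrivial (Module.End F V) := by
  have : Nontrivial V := by
    rw [← rank_pos_iff_nontrivial (R := F), hV]
    exact Cardinal.aleph0_pos
  infer_instance

open FirstOrder FirstOrder.Language FirstOrder.Language.Structure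

/-! ### Joint extensions in homogeneous injective structures -/

section Generic

variable {L : FirstOrder.Language.{0, 0}}

/-- The power of a structure, with the componentwise structure. -/
instance instStructurePi {Z M : Type*} [L.Structure M] : L.Structure (Z → M) where
  funMap f x z := funMap f fun i => x i z
  RelMap r x := ∀ z, RelMap r fun i => x i z

/-- Evaluation at a coordinate. -/
def evalHom {Z M : Type*} [L.Structure M] (z : Z) : (Z → M) →[L] M where
  toFun x := x z
  map_fun' _ _ := rfl
  map_rel' _ _ h := h z

/-- The homomorphism into a power with given components. -/
def piHom {Z A M : Type*} [L.Structure A] [L.Structure M] (f : Z → (A →[L] M)) :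
    A →[L] (Z → M) where
  toFun a z := f z a
  map_fun' φ x := by funext z; exact (f z).map_fun φ x
  map_rel' r x h z := (f z).map_rel r x h

/-- A homomorphism that is followed by some homomorphism to an embedding is an embedding. -/
def embeddingOfComp {A B C : Type*} [L.Structure A] [L.Structure B] [L.Structure C]
    (f : A →[L] B) (g : B →[L] C) (e : A ↪[L] C) (h : ∀ a, g (f a) = e a) : A ↪[L] B where
  toFun := f
  inj' a b hab := e.injective (by rw [← h, ← h]; exact congrArg g hab)
  map_fun' := f.map_fun
  map_rel' r x := by
    refine ⟨fun hr => ?_, f.map_rel r x⟩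
    have := g.map_rel r _ hr
    rw [← e.map_rel]
    convert this using 1
    funext i
    exact (h _).symm

/-- Compatible homomorphisms from a chain of substructures covering `N` have a union. -/
theorem exists_hom_of_chain {N T : Type*} [L.Structure N] [L.Structure T]
    (W : ℕ → L.Substructure N) (hW : Monotone W) (hcov : ∀ x, ∃ k, x ∈ W k)
    (f : ∀ k, W k →[L] T)
    (hf : ∀ k l x (hk : x ∈ W k) (hl : x ∈ W l), f k ⟨x, hk⟩ = f l ⟨x, hl⟩) :
    ∃ F : N →[L] T, ∀ k x (hk : x ∈ W k), F x = f k ⟨x, hk⟩ := by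
  choose κ hκ using hcov
  have hfin : ∀ {n : ℕ} (x : Fin n → N), ∃ k, ∀ i, x i ∈ W k := by
    intro n x
    obtain ⟨k, hk⟩ := Finite.bddAbove_range fun i => κ (x i)
    exact ⟨k, fun i => hW (hk ⟨i, rfl⟩) (hκ (x i))⟩
  refine ⟨⟨fun x => f (κ x) ⟨x, hκ x⟩, fun {n} φ x => ?_, fun {n} r x hr => ?_⟩,
    fun k x hk => hf _ _ _ _ _⟩
  · obtain ⟨k, hk⟩ := hfin x
    have hx : funMap φ x ∈ W k := (W k).fun_mem φ x hk
    rw [hf _ k _ _ hx]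
    have := (f k).map_fun φ fun i => ⟨x i, hk i⟩
    refine Eq.trans ?_ (this.trans ?_)
    · rfl
    · congr 1
      funext i
      exact hf _ _ _ _ _
  · obtain ⟨k, hk⟩ := hfin x
    have := (f k).map_rel r (fun i => ⟨x i, hk i⟩) hr
    convert this using 1
    funext i
    exact hf _ _ _ _ _

variable (L) in
/-- A structure as a bundled structure. -/
abbrev bundledOf (A : Type u) [L.Structure A] : Bundled.{u} L.Structure := ⟨A, inferInstance⟩

variable (L) in
/-- `M` realizes over its finitely generated substructures all their extensions in `K`. -/
def HasExtensions (K : Set (Bundled.{u} L.Structure)) (M : Type u) [L.Structure M] : Prop :=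
  ∀ W : L.Substructure M, W.FG → ∀ D : Bundled.{u} L.Structure, D ∈ K → ∀ e : W ↪[L] D,
    ∃ f : D ↪[L] M, ∀ w, f (e w) = w

variable (L) in
/-- Homomorphisms to `M` extend along embeddings between members of `K`. -/
def IsInjectiveFor (K : Set (Bundled.{u} L.Structure)) (M : Type*) [L.Structure M] : Prop :=
  ∀ A B : Bundled.{u} L.Structure, A ∈ K → B ∈ K → ∀ (e : A ↪[L] B) (h : A →[L] M),
    ∃ g : B →[L] M, ∀ a, g (e a) = h a

/-- A partial family of endomorphisms of `M` indexed by `Z` on the finitely generated substructure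
`W`, together with a partial section on the finitely generated substructure `X` of the power. -/
structure PartialSection (L : FirstOrder.Language.{0, 0}) (Z M : Type u) [L.Structure M] where
  W : L.Substructure M
  fg_W : W.FG
  F : W →[L] (Z → M)
  X : L.Substructure (Z → M)
  fg_X : X.FG
  u : X →[L] W
  F_u : ∀ x, F (u x) = x

namespace PartialSection

variable {Z M : Type u} [L.Structure M]

/-- `t` extends `s`. -/
def Extends (s t : PartialSection L Z M) : Prop :=
  (∃ h : s.W ≤ t.W, ∀ w, t.F (Substructure.inclusion h w) = s.F w) ∧
    ∃ h : s.X ≤ t.X, ∀ x, (t.u (Substructure.inclusion h x) : M) = s.u x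

theorem Extends.refl (s : PartialSection L Z M) : s.Extends s :=
  ⟨⟨le_rfl, fun _ => rfl⟩, le_rfl, fun _ => rfl⟩

theorem Extends.trans {s t r : PartialSection L Z M} (hst : s.Extends t) (htr : t.Extends r) :
    s.Extends r := by
  obtain ⟨⟨h₁, hF₁⟩, h₂, hu₁⟩ := hst
  obtain ⟨⟨h₃, hF₂⟩, h₄, hu₂⟩ := htr
  exact ⟨⟨h₁.trans h₃, fun w => (hF₂ (Substructure.inclusion h₁ w)).trans (hF₁ w)⟩,
    h₂.trans h₄, fun x => (hu₂ (Substructure.inclusion h₂ x)).trans (hu₁ x)⟩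

-- The back and forth starts with the diagonal on the substructure generated by ∅; evaluation at any
-- one coordinate is a section of it, whence `Nonempty Z`.
variable (L Z M) in
theorem nonempty [Nonempty Z] : Nonempty (PartialSection L Z M) := by
  obtain ⟨z⟩ := ‹Nonempty Z›
  let Δ : M →[L] (Z → M) := piHom fun _ => Hom.id L M
  have hX : ∀ x : (Substructure.map Δ ⊥ : L.Substructure (Z → M)),
      (evalHom z : (Z → M) →[L] M) x ∈ (⊥ : L.Substructure M) := by
    rintro ⟨_, w, hw, rfl⟩
    exact hw
  exact ⟨⟨⊥, Substructure.fg_bot, Δ.comp (Substructure.subtype _).toHom, Substructure.map Δ ⊥,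
    Substructure.fg_bot.map Δ,
    Hom.codRestrict ⊥ ((evalHom z).comp (Substructure.subtype _).toHom) hX, by
      rintro ⟨_, w, hw, rfl⟩
      rfl⟩⟩

variable {K : Set (Bundled.{u} L.Structure)}

/-- Each coordinate of F extends separately by injectivity; the section is unchanged. -/
theorem exists_extends_mem_W (hK : ∀ W : L.Substructure M, W.FG → bundledOf L W ∈ K)
    (inj : IsInjectiveFor L K M) (s : PartialSection L Z M) (m : M) :
    ∃ t, s.Extends t ∧ m ∈ t.W := by
  have hfg : (s.W ⊔ Substructure.closure L {m}).FG :=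
    s.fg_W.sup (Substructure.fg_closure_singleton m)
  have hle : s.W ≤ s.W ⊔ Substructure.closure L {m} := le_sup_left
  choose g hg using fun z => inj (bundledOf L s.W) (bundledOf L ↥(s.W ⊔ Substructure.closure L {m}))
    (hK _ s.fg_W) (hK _ hfg) (Substructure.inclusion hle) ((evalHom z).comp s.F)
  have hF : ∀ w, piHom g (Substructure.inclusion hle w) = s.F w :=
    fun w => funext fun z => hg z w
  exact ⟨⟨_, hfg, piHom g, s.X, s.fg_X, (Substructure.inclusion hle).toHom.comp s.u,
    fun x => (hF _).trans (s.F_u x)⟩, ⟨⟨hle, hF⟩, le_rfl, fun _ => rfl⟩,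
    (le_sup_right : _ ≤ s.W ⊔ _) (Substructure.subset_closure rfl)⟩

/-- The section must acquire a value at y, in general a new element of M. A structure containing W
and the desired value is found inside a power of M, and homogeneity then places it in M over W. -/
theorem exists_extends_mem_X [Nonempty Z]
    (pow : ∀ (Z : Type u) [Nonempty Z] (D : L.Substructure (Z → M)), D.FG → bundledOf L D ∈ K)
    (ext : HasExtensions L K M) (inj : IsInjectiveFor L K M) (s : PartialSection L Z M)
    (y : Z → M) : ∃ t, s.Extends t ∧ y ∈ t.X := by
  have hfg : (s.X ⊔ Substructure.closure L {y}).FG :=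
    s.fg_X.sup (Substructure.fg_closure_singleton y)
  have hle : s.X ≤ s.X ⊔ Substructure.closure L {y} := le_sup_left
  obtain ⟨v, hv⟩ := inj (bundledOf L s.X) (bundledOf L ↥(s.X ⊔ Substructure.closure L {y}))
    (pow _ _ s.fg_X) (pow _ _ hfg) (Substructure.inclusion hle) (s.W.subtype.toHom.comp s.u)
  let X' : L.Substructure (Z → M) := s.X ⊔ Substructure.closure L {y}
  -- `a` is the graph of F, and the extra coordinate `none` keeps w itself, which makes `a` an
  -- embedding. For `b` that coordinate is filled by v, so that `b` agrees with `a ∘ u` on the old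
  -- X.
  let a : s.W →[L] (Option Z → M) :=
    piHom fun o => o.elim s.W.subtype.toHom fun z => (evalHom z).comp s.F
  let b : X' →[L] (Option Z → M) :=
    piHom fun o => o.elim v fun z => (evalHom z).comp X'.subtype.toHom
  have hab : ∀ x : s.X, b (Substructure.inclusion hle x) = a (s.u x) := by
    intro x
    funext o
    cases o with
    | none => exact hv x
    | some z => exact (congrFun (s.F_u x) z).symm
  let D : L.Substructure (Option Z → M) := a.range ⊔ b.range
  have ha : ∀ w, a w ∈ D := fun w => (le_sup_left : _ ≤ D) (a.mem_range_self w)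
  have hb : ∀ x, b x ∈ D := fun x => (le_sup_right : _ ≤ D) (b.mem_range_self x)
  have hD : D.FG :=
    (((Substructure.fg_iff_structure_fg _).1 s.fg_W).range a).sup
      (((Substructure.fg_iff_structure_fg _).1 hfg).range b)
  let e : s.W ↪[L] D := embeddingOfComp (Hom.codRestrict D a ha)
    ((evalHom none).comp D.subtype.toHom) s.W.subtype fun _ => rfl
  obtain ⟨f, hf⟩ := ext s.W s.fg_W (bundledOf L D) (pow _ _ hD) e
  -- Forgetting the coordinate `none` extends F from W to D and is inverted by `b` on X'.
  let p : D →[L] (Z → M) :=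
    piHom fun z => (evalHom (some z)).comp D.subtype.toHom
  let f' : D ↪[L] M := f
  let W' : L.Substructure M := f'.toHom.range
  let b' : X' →[L] D := Hom.codRestrict D b hb
  refine ⟨⟨W', ((Substructure.fg_iff_structure_fg _).1 hD).range _,
    p.comp f'.equivRange.symm.toHom, X', hfg, f'.equivRange.toHom.comp b', ?_⟩,
    ⟨⟨?_, ?_⟩, hle, ?_⟩, (le_sup_right : _ ≤ X') (Substructure.subset_closure rfl)⟩
  · intro x
    change p (f'.equivRange.symm (f'.equivRange (b' x))) = x
    rw [FirstOrder.Language.Equiv.symm_apply_apply]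
    rfl
  · intro w hw
    exact ⟨e ⟨w, hw⟩, hf ⟨w, hw⟩⟩
  · intro w
    change p (f'.equivRange.symm _) = s.F w
    have : f'.equivRange (e w) = ⟨(w : M), ⟨e w, hf w⟩⟩ := Subtype.ext (hf w)
    have h2 := congrArg f'.equivRange.symm this
    rw [FirstOrder.Language.Equiv.symm_apply_apply] at h2
    exact (congrArg p h2).symm.trans rfl
  · intro x
    change f' (b' _) = s.u x
    have : b' (Substructure.inclusion hle x) = e (s.u x) := Subtype.ext (hab x)
    rw [this]
    exact hf _

end PartialSection

/-- The main construction: if the finitely generated substructures of powers of `M` lie in `K` and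
`M` is both homogeneous and injective for `K`, then there are endomorphisms `j n` of `M` through
which all sequences of endomorphisms jointly extend. -/
theorem exists_joint_extensions {M : Type u} [L.Structure M] [Countable M] [Nonempty M]
    {K : Set (Bundled.{u} L.Structure)}
    (pow : ∀ (Z : Type u) [Nonempty Z] (D : L.Substructure (Z → M)), D.FG → bundledOf L D ∈ K)
    (hK : ∀ W : L.Substructure M, W.FG → bundledOf L W ∈ K)
    (ext : HasExtensions L K M) (inj : IsInjectiveFor L K M) :
    ∃ j : ℕ → (M →[L] M), ∀ g : ℕ → (M →[L] M), ∃ f : M →[L] M, ∀ n, f.comp (j n) = g n := by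
  let Z : Type u := ℕ → (M →[L] M)
  have : Nonempty Z := ⟨fun _ => Hom.id L M⟩
  let ι : ℕ → (M →[L] (Z → M)) := fun n => piHom fun z => z n
  -- M^Z need not be countable, but only the points ιₙ m have to enter X, so there are countably
  -- many tasks.
  obtain ⟨τ, hτ⟩ := exists_surjective_nat (M ⊕ (ℕ × M))
  have step : ∀ (k : ℕ) (s : PartialSection L Z M), ∃ t, s.Extends t ∧
      (∀ m, τ k = Sum.inl m → m ∈ t.W) ∧ ∀ n m, τ k = Sum.inr (n, m) → ι n m ∈ t.X := by
    intro k s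
    rcases hk : τ k with m | ⟨n, m⟩
    · obtain ⟨t, hst, ht⟩ := s.exists_extends_mem_W hK inj m
      exact ⟨t, hst, fun m' h => (by cases h; exact ht), fun n m' h => by cases h⟩
    · obtain ⟨t, hst, ht⟩ := s.exists_extends_mem_X pow ext inj (ι n m)
      exact ⟨t, hst, fun m' h => (by cases h), fun n m' h => by cases h; exact ht⟩
  choose next hext hW hX using step
  obtain ⟨s₀⟩ := PartialSection.nonempty L Z M
  let s : ℕ → PartialSection L Z M := fun k => Nat.rec s₀ next k
  have hs : ∀ {k l}, k ≤ l → (s k).Extends (s l) := by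
    intro k l hkl
    induction l, hkl using Nat.le_induction with
    | base => exact .refl _
    | succ l _ ih => exact ih.trans (hext l (s l))
  obtain ⟨F, hF⟩ := exists_hom_of_chain (fun k => (s k).W) (fun k l h => (hs h).1.1)
    (fun m => by
      obtain ⟨k, hk⟩ := hτ (Sum.inl m)
      exact ⟨k + 1, hW k (s k) m hk⟩)
    (fun k => (s k).F) (by
      intro k l x hk hl
      rcases le_total k l with h | h
      · exact ((hs h).1.2 ⟨x, hk⟩).symm
      · exact (hs h).1.2 ⟨x, hl⟩)
  have hj : ∀ n, ∃ j : M →[L] M, ∀ k m (h : ι n m ∈ (s k).X), j m = (s k).u ⟨ι n m, h⟩ := by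
    intro n
    refine exists_hom_of_chain (fun k => (s k).X.comap (ι n))
      (fun k l h => Substructure.monotone_comap (hs h).2.1)
      (fun m => by
        obtain ⟨k, hk⟩ := hτ (Sum.inr (n, m))
        exact ⟨k + 1, hX k (s k) n m hk⟩)
      (fun k => ((s k).W.subtype.toHom.comp (s k).u).comp
        (Hom.codRestrict (s k).X ((ι n).comp (Substructure.subtype _).toHom) fun c => c.2)) ?_
    intro k l x hk hl
    rcases le_total k l with h | h
    · exact ((hs h).2.2 ⟨ι n x, hk⟩).symm
    · exact (hs h).2.2 ⟨ι n x, hl⟩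
  choose j hj using hj
  refine ⟨j, fun g => ⟨(evalHom g).comp F, fun n => ?_⟩⟩
  ext m
  obtain ⟨k, hk⟩ := hτ (Sum.inr (n, m))
  have hm : ι n m ∈ (s (k + 1)).X := hX k (s k) n m hk
  change F (j n m) g = g n m
  rw [hj n (k + 1) m hm, hF (k + 1) _ (Subtype.coe_prop _)]
  exact congrFun ((s (k + 1)).F_u ⟨ι n m, hm⟩) g

theorem hasExtensions_of_isFraisseLimit [Countable (Σ l, L.Functions l)] {M : Type u}
    [L.Structure M] [Countable M] {K : Set (Bundled.{u} L.Structure)} (h : IsFraisseLimit K M) :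
    HasExtensions L K M := by
  intro W hW D hD e
  rw [← h.age] at hD
  have := hD.2
  obtain ⟨f, hf⟩ := h.ultrahomogeneous.extend_embedding
    ((Substructure.fg_iff_structure_fg _).1 hW) W.subtype e
  exact ⟨f, fun w => (DFunLike.congr_fun hf w).symm⟩

theorem fg_mem_of_isFraisseLimit [Countable (Σ l, L.Functions l)] {M : Type u}
    [L.Structure M] [Countable M] {K : Set (Bundled.{u} L.Structure)} (h : IsFraisseLimit K M)
    (W : L.Substructure M) (hW : W.FG) : bundledOf L W ∈ K := by
  rw [← h.age]
  exact ⟨(Substructure.fg_iff_structure_fg _).1 hW, ⟨W.subtype⟩⟩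

/-- Injectivity of a homogeneous structure, by duality with respect to an injective cogenerator
`E`: the pushout of an embedding and a homomorphism is formed in a power of `E`. -/
theorem isInjectiveFor_of_cogenerator {M : Type u} [L.Structure M]
    {K : Set (Bundled.{u} L.Structure)} (E : Type) [L.Structure E]
    (hfg : ∀ A ∈ K, Structure.FG L A)
    (hK : ∀ W : L.Substructure M, W.FG → bundledOf L W ∈ K)
    (ext : HasExtensions L K M) (inj : IsInjectiveFor L K E)
    (powE : ∀ (Z : Type u) (D : L.Substructure (Z → E)), D.FG → bundledOf L D ∈ K)
    (sep : ∀ C ∈ K, ∀ x y : C, x ≠ y → ∃ φ : C →[L] E, φ x ≠ φ y)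
    (sepRel : ∀ C ∈ K, ∀ (n : ℕ) (r : L.Relations n) (x : Fin n → C), ¬ RelMap r x →
      ∃ φ : C →[L] E, ¬ RelMap r (φ ∘ x)) :
    IsInjectiveFor L K M := by
  intro A B hA hB e h
  let C : L.Substructure M := h.range
  have hC : C.FG := (hfg A hA).range h
  let h' : A →[L] C := Hom.codRestrict C h h.mem_range_self
  -- The coordinates are all pairs of E-valued homomorphisms that agree on A; they force the square
  -- to commute.
  let Z : Type u := {p : (B →[L] E) × (C →[L] E) // ∀ a, p.1 (e a) = p.2 (h' a)}
  -- Injectivity of E makes every ψ on C occur in some pair, so no information about C is lost in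
  -- the power.
  have hZ : ∀ ψ : C →[L] E, ∃ z : Z, z.1.2 = ψ := by
    intro ψ
    obtain ⟨φ, hφ⟩ := inj A B hA hB e (ψ.comp h')
    exact ⟨⟨(φ, ψ), hφ⟩, rfl⟩
  let b : B →[L] (Z → E) := piHom fun z => z.1.1
  let c : C →[L] (Z → E) := piHom fun z => z.1.2
  let D : L.Substructure (Z → E) := b.range ⊔ c.range
  have hb : ∀ x, b x ∈ D := fun x => (le_sup_left : _ ≤ D) (b.mem_range_self x)
  have hc : ∀ x, c x ∈ D := fun x => (le_sup_right : _ ≤ D) (c.mem_range_self x)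
  have hD : D.FG :=
    ((hfg B hB).range b).sup (((Substructure.fg_iff_structure_fg _).1 hC).range c)
  let c' : C →[L] D := Hom.codRestrict D c hc
  let i : C ↪[L] D :=
    { toFun := c'
      inj' := by
        intro x y hxy
        by_contra hne
        obtain ⟨ψ, hψ⟩ := sep (bundledOf L C) (hK C hC) x y hne
        obtain ⟨z, hz⟩ := hZ ψ
        refine hψ ?_
        rw [← hz]
        exact congrFun (congrArg Subtype.val hxy) z
      map_fun' := c'.map_fun
      map_rel' := by
        intro n r x
        refine ⟨fun hr => ?_, c'.map_rel r x⟩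
        by_contra hne
        obtain ⟨ψ, hψ⟩ := sepRel (bundledOf L C) (hK C hC) n r x hne
        obtain ⟨z, hz⟩ := hZ ψ
        refine hψ ?_
        rw [← hz]
        exact hr z }
  obtain ⟨f, hf⟩ := ext C hC (bundledOf L D) (powE Z D hD) i
  refine ⟨f.toHom.comp (Hom.codRestrict D b hb), fun a => ?_⟩
  have : (⟨b (e a), hb _⟩ : D) = i (h' a) := Subtype.ext (funext fun z => z.2 a)
  exact (congrArg f this).trans (hf _)

end Generic

theorem hasJointExtensions_of_equiv {L : FirstOrder.Language.{0, 0}} {M S : Type*}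
    [L.Structure M] [Mul S] (e : (M →[L] M) ≃ S) (he : ∀ f g, e (f.comp g) = e f * e g)
    (h : ∃ j : ℕ → (M →[L] M), ∀ g : ℕ → (M →[L] M), ∃ f : M →[L] M, ∀ n, f.comp (j n) = g n) :
    HasJointExtensions S := by
  obtain ⟨j, hj⟩ := h
  refine ⟨fun n => e (j n), fun g => ?_⟩
  obtain ⟨f, hf⟩ := hj fun n => e.symm (g n)
  exact ⟨e f, fun n => by rw [← he, hf, Equiv.apply_symm_apply]⟩

theorem exists_embedding_of_isFraisseLimit {L : FirstOrder.Language.{0, 0}}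
    [Countable (Σ l, L.Functions l)] {M : Type u}
    [L.Structure M] [Countable M] {K : Set (Bundled.{u} L.Structure)} (h : IsFraisseLimit K M)
    {D : Bundled.{u} L.Structure} (hD : D ∈ K) : Nonempty (D ↪[L] M) := by
  rw [← h.age] at hD
  exact hD.2

/-! ### The random graph -/

section Graph

theorem mem_finiteGraphs {N : Type u} [S : FirstOrder.Language.graph.Structure N] [hN : Finite N]
    (irrefl : ∀ x : Fin 2 → N, RelMap adj x → x 0 ≠ x 1)
    (symm : ∀ x y : Fin 2 → N, x 0 = y 1 → x 1 = y 0 → RelMap adj x → RelMap adj y) :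
    bundledOf FirstOrder.Language.graph N ∈ finiteGraphs := by
  have : N ⊨ Theory.simpleGraph := by
    rw [Theory.simpleGraph_model_iff]
    exact ⟨⟨fun x hx => irrefl _ hx rfl⟩, ⟨fun x y h => symm _ _ rfl rfl h⟩⟩
  exact ⟨hN, simpleGraphOfStructure N, (structure_simpleGraphOfStructure (S := S)).symm⟩

/-- Members of the class carry a structure only equal to that of a graph; substituting the equation
once makes later unfolding definitional. The analogues for the other classes serve the same end. -/
theorem finiteGraphs_induction {p : ∀ A, A ∈ finiteGraphs.{u} → Prop}
    (h : ∀ (A : Type u) (G : SimpleGraph A) [Finite A],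
      p ⟨A, G.structure⟩ ⟨inferInstanceAs (Finite A), G, rfl⟩) (A) (hA : A ∈ finiteGraphs) :
    p A hA := by
  have aux : ∀ (A : Type u) (S : FirstOrder.Language.graph.Structure A) (G : SimpleGraph A)
      (_ : S = G.structure) [Finite A] (hA : ⟨A, S⟩ ∈ finiteGraphs), p ⟨A, S⟩ hA := by
    rintro A _ G rfl _ hA
    exact h A G
  have := hA.1
  obtain ⟨_, G, hG⟩ := id hA
  exact aux A.1 A.2 G hG hA

/-- One coordinate suffices to exclude loops. The empty power is a single looped point, so `Nonempty
Z` is essential. -/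
theorem powers_mem_finiteGraphs {V : Type u} (G : SimpleGraph V) (Z : Type u) [Nonempty Z] :
    letI := G.structure
    ∀ D : FirstOrder.Language.graph.Substructure (Z → V), D.FG →
      bundledOf FirstOrder.Language.graph D ∈ finiteGraphs := by
  let := G.structure
  intro D hD
  have := hD.finite
  obtain ⟨z⟩ := ‹Nonempty Z›
  refine mem_finiteGraphs (fun x hx h01 => ?_) fun x y h₀ h₁ hx z => ?_
  · exact G.ne_of_adj (hx z) (congrFun (congrArg Subtype.val h01) z)
  · have h := G.adj_symm (hx z)
    change G.Adj ((y 0 : Z → V) z) ((y 1 : Z → V) z)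
    rw [← h₀, ← h₁]
    exact h

theorem isInjectiveFor_finiteGraphs {V : Type u} (G : SimpleGraph V) :
    letI := G.structure
    HasExtensions FirstOrder.Language.graph finiteGraphs V →
      IsInjectiveFor FirstOrder.Language.graph finiteGraphs.{u} V := by
  let := G.structure
  intro ext A B hA hB e h
  induction A, hA using finiteGraphs_induction with | _ A GA
  induction B, hB using finiteGraphs_induction with | _ B GB
  let := GA.structure
  let := GB.structure
  let C := h.range
  have hC : C.FG := (FG.of_finite (M := A)).range h
  have finC : Finite C := hC.finite
  have he : ∀ a a' : A, GB.Adj (e a) (e a') ↔ GA.Adj a a' := fun a a' => e.map_rel adj ![a, a']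
  have hh : ∀ a a' : A, GA.Adj a a' → G.Adj (h a) (h a') := fun a a' => h.map_rel adj ![a, a']
  -- This glues B to C = h(A): a vertex of B is joined to c when it is adjacent to some preimage of
  -- c. The copy of A inside B stays as superfluous vertices, which the map `q` below avoids.
  let GD : SimpleGraph (B ⊕ C) :=
    { Adj
      | .inl b, .inl b' => GB.Adj b b'
      | .inl b, .inr c => ∃ a, GB.Adj b (e a) ∧ h a = c
      | .inr c, .inl b => ∃ a, GB.Adj b (e a) ∧ h a = c
      | .inr c, .inr c' => G.Adj (c : V) c'
      symm := ⟨by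
        rintro (b | c) (b' | c') hbc
        · exact GB.adj_symm hbc
        · exact hbc
        · exact hbc
        · exact G.adj_symm hbc⟩
      loopless := ⟨by
        rintro (b | c) hbc
        · exact GB.ne_of_adj hbc rfl
        · exact G.ne_of_adj hbc rfl⟩ }
  let := GD.structure
  let i : C ↪[FirstOrder.Language.graph] (B ⊕ C) :=
    { toFun := Sum.inr
      inj' := Sum.inr_injective
      map_fun' := fun φ => isEmptyElim φ
      map_rel' := by
        rintro _ ⟨⟩ x
        rfl }
  obtain ⟨f, hf⟩ := ext C hC ⟨B ⊕ C, GD.structure⟩ ⟨inferInstance, GD, rfl⟩ i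
  let f' : (B ⊕ C) ↪[FirstOrder.Language.graph] V := f
  have hf' : ∀ x y, G.Adj (f' x) (f' y) ↔ GD.Adj x y := fun x y => f'.map_rel adj ![x, y]
  classical
  let q : B → B ⊕ C := fun b =>
    if hb : ∃ a, e a = b then .inr ⟨h hb.choose, h.mem_range_self _⟩ else .inl b
  have hq : ∀ a, q (e a) = .inr ⟨h a, h.mem_range_self _⟩ := by
    intro a
    have ha : ∃ a', e a' = e a := ⟨a, rfl⟩
    have : ha.choose = a := e.injective ha.choose_spec
    simp only [q, dif_pos ha, this]
  have hq' : ∀ b, (¬ ∃ a, e a = b) → q b = .inl b := fun b hb => dif_neg hb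
  have hadj : ∀ b b', GB.Adj b b' → GD.Adj (q b) (q b') := by
    intro b b' hbb
    by_cases hb : ∃ a, e a = b <;> by_cases hb' : ∃ a, e a = b'
    · obtain ⟨a, rfl⟩ := hb
      obtain ⟨a', rfl⟩ := hb'
      rw [hq, hq]
      exact hh _ _ ((he _ _).1 hbb)
    · obtain ⟨a, rfl⟩ := hb
      rw [hq, hq' _ hb']
      exact ⟨a, GB.adj_symm hbb, rfl⟩
    · obtain ⟨a, rfl⟩ := hb'
      rw [hq, hq' _ hb]
      exact ⟨a, hbb, rfl⟩
    · rw [hq' _ hb, hq' _ hb']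
      exact hbb
  refine ⟨⟨fun b => f' (q b), fun φ => isEmptyElim φ, ?_⟩, fun a => ?_⟩
  · rintro _ ⟨⟩ x hx
    exact (hf' _ _).2 (hadj _ _ hx)
  · change f' (q (e a)) = h a
    rw [hq]
    exact hf ⟨h a, h.mem_range_self _⟩

theorem hasJointExtensions_graph {V : Type u} [Countable V] {G : SimpleGraph V}
    (hG : IsRandomGraph G) : Nontrivial (G →g G) ∧ HasJointExtensions (G →g G) := by
  let := G.structure
  have hG : IsFraisseLimit finiteGraphs V := hG
  have ext := hasExtensions_of_isFraisseLimit hG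
  let : FirstOrder.Language.graph.Structure (ULift.{u} Bool) :=
    (⊥ : SimpleGraph (ULift.{u} Bool)).structure
  obtain ⟨i⟩ := exists_embedding_of_isFraisseLimit hG
    (D := bundledOf FirstOrder.Language.graph (ULift.{u} Bool)) ⟨inferInstance, ⊥, rfl⟩
  let x := i ⟨true⟩
  let y := i ⟨false⟩
  have hxy : x ≠ y := fun h => by cases i.injective h
  have : Nonempty V := ⟨x⟩
  let e : (V →[FirstOrder.Language.graph] V) ≃ (G →g G) :=
    { toFun := fun f => ⟨f, fun {a b} h => f.map_rel adj ![a, b] h⟩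
      invFun := fun f => ⟨f, fun φ => isEmptyElim φ, by
        rintro _ ⟨⟩ x hx
        exact f.map_rel hx⟩
      left_inv := fun _ => rfl
      right_inv := fun _ => rfl }
  refine ⟨?_, hasJointExtensions_of_equiv e (fun _ _ => rfl) (exists_joint_extensions
    (fun Z _ D hD => powers_mem_finiteGraphs G Z D hD) (fg_mem_of_isFraisseLimit hG) ext
    (isInjectiveFor_finiteGraphs G ext))⟩
  -- Constant maps are not graph endomorphisms, so an endomorphism other than the identity is
  -- obtained from homogeneity, moving x to y.
  let S := Substructure.closure FirstOrder.Language.graph {x}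
  have hS : ∀ s : S, (s : V) = x := by
    intro s
    have := s.2
    rw [Substructure.mem_closure_iff_of_isRelational] at this
    exact this
  let p : S ↪[FirstOrder.Language.graph] V :=
    { toFun := fun _ => y
      inj' := fun s t _ => Subtype.ext ((hS s).trans (hS t).symm)
      map_fun' := fun φ => isEmptyElim φ
      map_rel' := by
        rintro _ ⟨⟩ z
        refine iff_of_false (fun h => G.ne_of_adj h rfl) fun h => ?_
        exact G.ne_of_adj h ((hS (z 0)).trans (hS (z 1)).symm) }
  obtain ⟨g, hg⟩ := hG.ultrahomogeneous S (Substructure.fg_closure_singleton x) p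
  have hgx : y = g x := DFunLike.congr_fun hg ⟨x, Substructure.subset_closure rfl⟩
  refine ⟨e (Hom.id _ _), e g.toHom, fun h => hxy ?_⟩
  rw [hgx]
  exact DFunLike.congr_fun h x

end Graph

/-! ### The generic poset -/

section Poset

theorem mem_finitePosets {N : Type u} [S : FirstOrder.Language.order.Structure N] [hN : Finite N]
    [P : PartialOrder N]
    (h : ∀ x : Fin 2 → N, RelMap (L := FirstOrder.Language.order) orderRel.le x ↔
      x 0 ≤ x 1) : bundledOf FirstOrder.Language.order N ∈ finitePosets := by
  refine ⟨hN, P, ?_⟩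
  ext n φ x
  · exact isEmptyElim φ
  · cases φ
    exact h x

theorem finitePosets_induction {p : ∀ A, A ∈ finitePosets.{u} → Prop}
    (h : ∀ (A : Type u) [PartialOrder A] [Finite A],
      p ⟨A, orderStructure A⟩ ⟨inferInstanceAs (Finite A), inferInstance, rfl⟩) (A)
    (hA : A ∈ finitePosets) : p A hA := by
  have aux : ∀ (A : Type u) (S : FirstOrder.Language.order.Structure A) [PartialOrder A]
      (_ : S = orderStructure A) [Finite A] (hA : ⟨A, S⟩ ∈ finitePosets), p ⟨A, S⟩ hA := by
    rintro A _ _ rfl _ hA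
    exact h A
  have := hA.1
  obtain ⟨_, P, hP⟩ := id hA
  exact aux A.1 A.2 hP hA

theorem powers_mem_finitePosets (P Z : Type*) [PartialOrder P] :
    letI := orderStructure P
    ∀ D : FirstOrder.Language.order.Substructure (Z → P), D.FG →
      bundledOf FirstOrder.Language.order D ∈ finitePosets := by
  let := orderStructure P
  intro D hD
  have := hD.finite
  exact mem_finitePosets fun x => Iff.rfl

theorem isInjectiveFor_finitePosets_prop :
    letI := orderStructure Prop
    IsInjectiveFor FirstOrder.Language.order finitePosets Prop := by
  let := orderStructure Prop
  intro A B hA hB e h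
  induction A, hA using finitePosets_induction with | _ A
  induction B, hB using finitePosets_induction with | _ B
  let := orderStructure A
  let := orderStructure B
  have he : ∀ a a' : A, e a ≤ e a' ↔ a ≤ a' := fun a a' => e.map_rel orderRel.le ![a, a']
  have hh : ∀ a a' : A, a ≤ a' → h a → h a' := fun a a' => h.map_rel orderRel.le ![a, a']
  -- The up-set of A given by h extends to the up-set it generates in B.
  refine ⟨⟨fun b => ∃ a, h a ∧ e a ≤ b, fun φ => isEmptyElim φ, ?_⟩, fun a => propext ⟨?_, ?_⟩⟩
  · rintro _ ⟨⟩ x hx ⟨a, ha, hax⟩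
    exact ⟨a, ha, le_trans hax hx⟩
  · rintro ⟨a', ha', hle⟩
    exact hh _ _ ((he _ _).1 hle) ha'
  · exact fun ha => ⟨a, ha, le_rfl⟩

theorem hasJointExtensions_orderHom {P : Type u} [Countable P] [PartialOrder P]
    (hP : IsGenericPoset P) : Nontrivial (P →o P) ∧ HasJointExtensions (P →o P) := by
  let := orderStructure P
  let := orderStructure Prop
  have hP : IsFraisseLimit finitePosets P := hP
  let := orderStructure (ULift.{u} Bool)
  obtain ⟨i⟩ := exists_embedding_of_isFraisseLimit hP
    (D := bundledOf FirstOrder.Language.order (ULift.{u} Bool))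
    (mem_finitePosets fun x => Iff.rfl)
  have hi : i ⟨true⟩ ≠ i ⟨false⟩ := fun h => by cases i.injective h
  have : Nonempty P := ⟨i ⟨true⟩⟩
  let e : (P →[FirstOrder.Language.order] P) ≃ (P →o P) :=
    { toFun := fun f => ⟨f, fun a b h => f.map_rel orderRel.le ![a, b] h⟩
      invFun := fun f => ⟨f, fun φ => isEmptyElim φ, by
        rintro _ ⟨⟩ x hx
        exact f.monotone hx⟩
      left_inv := fun _ => rfl
      right_inv := fun _ => rfl }
  have hK := fg_mem_of_isFraisseLimit hP
  have ext := hasExtensions_of_isFraisseLimit hP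
  refine ⟨⟨OrderHom.const P (i ⟨true⟩), OrderHom.const P (i ⟨false⟩),
    fun h => hi (DFunLike.congr_fun h (i ⟨true⟩))⟩,
    hasJointExtensions_of_equiv e (fun _ _ => rfl) (exists_joint_extensions
      (fun Z _ => powers_mem_finitePosets P Z) hK ext (isInjectiveFor_of_cogenerator Prop
        ?_ hK ext isInjectiveFor_finitePosets_prop (fun Z => powers_mem_finitePosets Prop Z) ?_ ?_))⟩
  · intro A hA
    have := hA.1
    exact FG.of_finite
  all_goals
    intro C hC
    induction C, hC using finitePosets_induction with | _ C
    let := orderStructure C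
  · have hom : ∀ c : C, ∃ φ : C →[FirstOrder.Language.order] Prop, ∀ x, φ x = (c ≤ x) := fun c =>
      ⟨⟨fun x => c ≤ x, fun φ => isEmptyElim φ, by
        rintro _ ⟨⟩ x hx hc
        exact le_trans hc hx⟩, fun _ => rfl⟩
    intro x y hxy
    by_contra! hcon
    refine hxy (le_antisymm ?_ ?_)
    · obtain ⟨φ, hφ⟩ := hom x
      have := hcon φ
      rw [hφ, hφ] at this
      exact this ▸ le_refl x
    · obtain ⟨φ, hφ⟩ := hom y
      have := hcon φ
      rw [hφ, hφ] at this
      exact this ▸ le_refl y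
  · rintro _ ⟨⟩ x hx
    -- The principal up-set of `x 0` detects that `x 0 ≤ x 1` fails.
    refine ⟨⟨fun y => x 0 ≤ y, fun φ => isEmptyElim φ, ?_⟩, fun h => hx ?_⟩
    · rintro _ ⟨⟩ z hz hc
      exact le_trans hc hz
    · exact h (le_refl (x 0))

end Poset

/-! ### The universal homogeneous semilattice -/

section Semilattice

theorem mem_finiteSemilattices {N : Type u} [S : semilatticeLang.Structure N] [hN : Finite N]
    [P : SemilatticeInf N]
    (h : ∀ x : Fin 2 → N, funMap (L := semilatticeLang) SemilatticeFunc.inf x = x 0 ⊓ x 1) :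
    bundledOf semilatticeLang N ∈ finiteSemilattices := by
  refine ⟨hN, P, ?_⟩
  ext n φ x
  · cases φ
    exact h x
  · exact φ.elim

theorem finiteSemilattices_induction {p : ∀ A, A ∈ finiteSemilattices.{u} → Prop}
    (h : ∀ (A : Type u) [SemilatticeInf A] [Finite A],
      p ⟨A, semilatticeStructure A⟩ ⟨inferInstanceAs (Finite A), inferInstance, rfl⟩) (A)
    (hA : A ∈ finiteSemilattices) : p A hA := by
  have aux : ∀ (A : Type u) (S : semilatticeLang.Structure A) [SemilatticeInf A]
      (_ : S = semilatticeStructure A) [Finite A] (hA : ⟨A, S⟩ ∈ finiteSemilattices),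
      p ⟨A, S⟩ hA := by
    rintro A _ _ rfl _ hA
    exact h A
  have := hA.1
  obtain ⟨_, P, hP⟩ := id hA
  exact aux A.1 A.2 hP hA

theorem powers_mem_finiteSemilattices (P Z : Type*) [SemilatticeInf P] :
    letI := semilatticeStructure P
    ∀ D : semilatticeLang.Substructure (Z → P), D.FG →
      bundledOf semilatticeLang D ∈ finiteSemilattices := by
  let := semilatticeStructure P
  intro D hD
  have hinf : ∀ ⦃x y : Z → P⦄, x ∈ D → y ∈ D → x ⊓ y ∈ D := fun x y hx hy =>
    D.fun_mem SemilatticeFunc.inf ![x, y] (by simp [Fin.forall_fin_two, hx, hy])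
  let := Subtype.semilatticeInf hinf
  have : Finite D := by
    obtain ⟨s, hs, rfl⟩ := Substructure.fg_def.1 hD
    let T : semilatticeLang.Substructure (Z → P) := ⟨infClosure s, by
      rintro _ ⟨⟩ x hx
      exact infClosed_infClosure (hx 0) (hx 1)⟩
    have hle : Substructure.closure semilatticeLang s ≤ T :=
      Substructure.closure_le.2 subset_infClosure
    exact hs.infClosure.subset hle
  exact mem_finiteSemilattices fun x => rfl

/-- An inf-homomorphism as a homomorphism of first-order structures. -/
def semilatticeHom {A B : Type*} [SemilatticeInf A] [SemilatticeInf B] (f : InfHom A B) :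
    letI := semilatticeStructure A
    letI := semilatticeStructure B
    A →[semilatticeLang] B :=
  letI := semilatticeStructure A
  letI := semilatticeStructure B
  { toFun := f
    map_fun' := by
      rintro _ ⟨⟩ x
      exact map_inf f (x 0) (x 1)
    map_rel' := fun r => r.elim }

theorem isInjectiveFor_finiteSemilattices_prop :
    letI := semilatticeStructure Prop
    IsInjectiveFor semilatticeLang finiteSemilattices Prop := by
  let := semilatticeStructure Prop
  intro A B hA hB e h
  induction A, hA using finiteSemilattices_induction with | _ A
  induction B, hB using finiteSemilattices_induction with | _ B
  let := semilatticeStructure A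
  let := semilatticeStructure B
  have he : ∀ a a' : A, e (a ⊓ a') = e a ⊓ e a' :=
    fun a a' => e.map_fun SemilatticeFunc.inf ![a, a']
  have hh : ∀ a a' : A, h (a ⊓ a') = (h a ⊓ h a') :=
    fun a a' => h.map_fun SemilatticeFunc.inf ![a, a']
  -- The up-set generated by a possibly empty filter is again closed under meets.
  let ψ : InfHom B Prop :=
    { toFun := fun b => ∃ a, h a ∧ e a ≤ b
      map_inf' := fun b c => propext ⟨
        fun ⟨a, ha, hle⟩ => ⟨⟨a, ha, hle.trans inf_le_left⟩, ⟨a, ha, hle.trans inf_le_right⟩⟩,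
        fun ⟨⟨a, ha, hab⟩, ⟨a', ha', hac⟩⟩ => ⟨a ⊓ a', (hh a a').symm ▸ ⟨ha, ha'⟩,
          (he a a').symm ▸ inf_le_inf hab hac⟩⟩ }
  refine ⟨semilatticeHom ψ, fun a => propext ⟨?_, fun ha => ⟨a, ha, le_rfl⟩⟩⟩
  rintro ⟨a', ha', hle⟩
  have : a' ⊓ a = a' := e.injective (by rw [he]; exact inf_eq_left.2 hle)
  rw [← this, hh] at ha'
  exact ha'.2

theorem hasJointExtensions_infHom {P : Type u} [Countable P] [SemilatticeInf P]
    (hP : IsUniversalHomogeneousSemilattice P) :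
    Nontrivial (InfHom P P) ∧ HasJointExtensions (InfHom P P) := by
  let := semilatticeStructure P
  let := semilatticeStructure Prop
  have hP : IsFraisseLimit finiteSemilattices P := hP
  let := semilatticeStructure (ULift.{u} Bool)
  obtain ⟨i⟩ := exists_embedding_of_isFraisseLimit hP
    (D := bundledOf semilatticeLang (ULift.{u} Bool))
    (mem_finiteSemilattices fun x => rfl)
  have hi : i ⟨true⟩ ≠ i ⟨false⟩ := fun h => by cases i.injective h
  have : Nonempty P := ⟨i ⟨true⟩⟩
  let e : (P →[semilatticeLang] P) ≃ InfHom P P :=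
    { toFun := fun f => ⟨f, fun a b => f.map_fun SemilatticeFunc.inf ![a, b]⟩
      invFun := semilatticeHom
      left_inv := fun _ => rfl
      right_inv := fun _ => rfl }
  have hK := fg_mem_of_isFraisseLimit hP
  have ext := hasExtensions_of_isFraisseLimit hP
  refine ⟨⟨⟨fun _ => i ⟨true⟩, fun _ _ => (inf_idem _).symm⟩,
      ⟨fun _ => i ⟨false⟩, fun _ _ => (inf_idem _).symm⟩,
      fun h => hi (DFunLike.congr_fun h (i ⟨true⟩))⟩,
    hasJointExtensions_of_equiv e (fun _ _ => rfl) (exists_joint_extensions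
      (fun Z _ => powers_mem_finiteSemilattices P Z) hK ext (isInjectiveFor_of_cogenerator Prop
        ?_ hK ext isInjectiveFor_finiteSemilattices_prop
        (fun Z => powers_mem_finiteSemilattices Prop Z) ?_ fun _ _ _ r => r.elim))⟩
  · intro A hA
    have := hA.1
    exact FG.of_finite
  · intro C hC
    induction C, hC using finiteSemilattices_induction with | _ C
    let φ : C → InfHom C Prop := fun c => ⟨fun x => c ≤ x, fun x y => propext le_inf_iff⟩
    intro x y hxy
    by_contra! hcon
    have hx : (x ≤ x) = (x ≤ y) := hcon (semilatticeHom (φ x))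
    have hy : (y ≤ x) = (y ≤ y) := hcon (semilatticeHom (φ y))
    exact hxy (le_antisymm (hx ▸ le_refl x) (hy ▸ le_refl y))

end Semilattice

/-! ### The universal homogeneous distributive lattice -/

section DistribLattice

/-- Disjoint filters and ideals of a distributive lattice are separated by a homomorphism to the
two-element lattice. -/
theorem exists_latticeHom_prop {B : Type*} [DistribLattice B] {F I : Set B} (hF : F.Nonempty)
    (hI : I.Nonempty) (hinf : InfClosed F) (hsup : SupClosed I)
    (hFI : ∀ f ∈ F, ∀ i ∈ I, ¬ f ≤ i) :
    ∃ φ : LatticeHom B Prop, (∀ f ∈ F, φ f) ∧ ∀ i ∈ I, ¬ φ i := by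
  let I' : Order.Ideal B := Order.IsIdeal.toIdeal (I := {b | ∃ i ∈ I, b ≤ i})
    { IsLowerSet := fun a b hba ⟨i, hi, hai⟩ => ⟨i, hi, hba.trans hai⟩
      Nonempty := ⟨hI.some, hI.some, hI.some_mem, le_rfl⟩
      Directed := fun a ⟨i, hi, hai⟩ b ⟨j, hj, hbj⟩ =>
        ⟨i ⊔ j, ⟨i ⊔ j, hsup hi hj, le_rfl⟩, hai.trans le_sup_left, hbj.trans le_sup_right⟩ }
  let F' : Order.PFilter B := Order.IsPFilter.toPFilter (F := {b | ∃ f ∈ F, f ≤ b})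
    (Order.IsPFilter.of_def ⟨hF.some, hF.some, hF.some_mem, le_rfl⟩
      (fun a ⟨i, hi, hai⟩ b ⟨j, hj, hbj⟩ =>
        ⟨i ⊓ j, ⟨i ⊓ j, hinf hi hj, le_rfl⟩, inf_le_left.trans hai, inf_le_right.trans hbj⟩)
      (fun {x y} hxy ⟨i, hi, hai⟩ => ⟨i, hi, hai.trans hxy⟩))
  have hdisj : Disjoint (F' : Set B) (I' : Set B) := by
    rw [Set.disjoint_left]
    rintro b ⟨f, hf, hfb⟩ ⟨i, hi, hbi⟩
    exact hFI f hf i hi (hfb.trans hbi)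
  -- The complement of a prime ideal is the required homomorphism to `Prop`.
  obtain ⟨J, hJ, hIJ, hFJ⟩ := DistribLattice.prime_ideal_of_disjoint_filter_ideal hdisj
  refine ⟨⟨⟨fun b => b ∉ J, fun a b => ?_⟩, fun a b => ?_⟩, fun f hf => ?_, fun i hi => ?_⟩
  · simp only [Order.Ideal.sup_mem_iff, sup_Prop_eq, eq_iff_iff]
    tauto
  · change (a ⊓ b ∉ J) = (a ∉ J ∧ b ∉ J)
    have h1 : a ⊓ b ∈ J → a ∈ J ∨ b ∈ J := hJ.mem_or_mem
    have h2 : a ∈ J → a ⊓ b ∈ J := J.lower inf_le_left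
    have h3 : b ∈ J → a ⊓ b ∈ J := J.lower inf_le_right
    exact propext (by tauto)
  · exact Set.disjoint_left.1 hFJ ⟨f, hf, le_rfl⟩
  · exact not_not.2 (hIJ ⟨i, hi, le_rfl⟩)

theorem exists_latticeHom_prop_of_not_le {B : Type*} [DistribLattice B] {x y : B} (h : ¬ x ≤ y) :
    ∃ φ : LatticeHom B Prop, φ x ∧ ¬ φ y := by
  obtain ⟨φ, hx, hy⟩ := exists_latticeHom_prop (Set.singleton_nonempty x) (Set.singleton_nonempty y)
    (by simp) (by simp) (by simpa using h)
  exact ⟨φ, hx x rfl, hy y rfl⟩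

theorem exists_latticeHom_prop_ne {B : Type*} [DistribLattice B] {x y : B} (h : x ≠ y) :
    ∃ φ : LatticeHom B Prop, φ x ≠ φ y := by
  by_cases hxy : x ≤ y
  · obtain ⟨φ, hy, hx⟩ := exists_latticeHom_prop_of_not_le fun hyx => h (le_antisymm hxy hyx)
    exact ⟨φ, fun heq => hx (heq ▸ hy)⟩
  · obtain ⟨φ, hx, hy⟩ := exists_latticeHom_prop_of_not_le hxy
    exact ⟨φ, fun heq => hy (heq ▸ hx)⟩

/-- The two-element lattice is injective among distributive lattices. -/
theorem exists_latticeHom_prop_extending {A B : Type*} [DistribLattice A] [DistribLattice B]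
    (e : LatticeHom A B) (he : Function.Injective e) (h : LatticeHom A Prop) :
    ∃ g : LatticeHom B Prop, ∀ a, g (e a) = h a := by
  -- Without bounds h may be constant; then its filter or its ideal is empty and separation does not
  -- apply, but a constant extension works.
  by_cases hF : ∃ a, h a
  swap
  · exact ⟨⟨⟨fun _ => False, fun _ _ => by simp⟩, fun _ _ => by simp⟩,
      fun a => propext ⟨False.elim, fun ha => hF ⟨a, ha⟩⟩⟩
  by_cases hI : ∃ a, ¬ h a
  swap
  · exact ⟨⟨⟨fun _ => True, fun _ _ => by simp⟩, fun _ _ => by simp⟩,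
      fun a => propext ⟨fun _ => not_not.1 fun ha => hI ⟨a, ha⟩, fun _ => trivial⟩⟩
  obtain ⟨f, hf⟩ := hF
  obtain ⟨i, hi⟩ := hI
  have hinf : ∀ a b, h (a ⊓ b) ↔ h a ∧ h b := fun a b => iff_of_eq (map_inf h a b)
  have hsup : ∀ a b, h (a ⊔ b) ↔ h a ∨ h b := fun a b => iff_of_eq (map_sup h a b)
  obtain ⟨g, hg, hg'⟩ := exists_latticeHom_prop (F := e '' {a | h a}) (I := e '' {a | ¬ h a})
    ⟨e f, f, hf, rfl⟩ ⟨e i, i, hi, rfl⟩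
    (by
      rintro _ ⟨a, ha, rfl⟩ _ ⟨b, hb, rfl⟩
      exact ⟨a ⊓ b, (hinf a b).2 ⟨ha, hb⟩, map_inf e a b⟩)
    (by
      rintro _ ⟨a, ha, rfl⟩ _ ⟨b, hb, rfl⟩
      exact ⟨a ⊔ b, fun hab => ((hsup a b).1 hab).elim ha hb, map_sup e a b⟩)
    (by
      rintro _ ⟨a, ha, rfl⟩ _ ⟨b, hb, rfl⟩ hab
      have hab' : a ⊓ b = a := he (by rw [map_inf]; exact inf_eq_left.2 hab)
      have ha : h (a ⊓ b) := hab'.symm ▸ ha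
      exact hb ((hinf a b).1 ha).2)
  refine ⟨g, fun a => ?_⟩
  by_cases ha : h a
  · exact propext ⟨fun _ => ha, fun _ => hg _ ⟨a, ha, rfl⟩⟩
  · exact propext ⟨fun hga => absurd hga (hg' _ ⟨a, ha, rfl⟩), fun h => absurd h ha⟩

theorem mem_finiteDistribLattices {N : Type u} [S : latticeLang.Structure N] [hN : Finite N]
    [P : DistribLattice N]
    (hinf : ∀ x : Fin 2 → N, funMap (L := latticeLang) LatticeFunc.inf x = x 0 ⊓ x 1)
    (hsup : ∀ x : Fin 2 → N, funMap (L := latticeLang) LatticeFunc.sup x = x 0 ⊔ x 1) :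
    bundledOf latticeLang N ∈ finiteDistribLattices := by
  refine ⟨hN, P, ?_⟩
  ext n φ x
  · cases φ
    · exact hinf x
    · exact hsup x
  · exact φ.elim

theorem finiteDistribLattices_induction {p : ∀ A, A ∈ finiteDistribLattices.{u} → Prop}
    (h : ∀ (A : Type u) [DistribLattice A] [Finite A],
      p ⟨A, latticeStructure A⟩ ⟨inferInstanceAs (Finite A), inferInstance, rfl⟩) (A)
    (hA : A ∈ finiteDistribLattices) : p A hA := by
  have aux : ∀ (A : Type u) (S : latticeLang.Structure A) [DistribLattice A]
      (_ : S = latticeStructure A) [Finite A] (hA : ⟨A, S⟩ ∈ finiteDistribLattices),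
      p ⟨A, S⟩ hA := by
    rintro A _ _ rfl _ hA
    exact h A
  have := hA.1
  obtain ⟨_, P, hP⟩ := id hA
  exact aux A.1 A.2 hP hA

theorem powers_mem_finiteDistribLattices (P Z : Type*) [DistribLattice P] :
    letI := latticeStructure P
    ∀ D : latticeLang.Substructure (Z → P), D.FG →
      bundledOf latticeLang D ∈ finiteDistribLattices := by
  let := latticeStructure P
  intro D hD
  have hinf : ∀ ⦃x y : Z → P⦄, x ∈ D → y ∈ D → x ⊓ y ∈ D := fun x y hx hy =>
    D.fun_mem LatticeFunc.inf ![x, y] (by simp [Fin.forall_fin_two, hx, hy])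
  have hsup : ∀ ⦃x y : Z → P⦄, x ∈ D → y ∈ D → x ⊔ y ∈ D := fun x y hx hy =>
    D.fun_mem LatticeFunc.sup ![x, y] (by simp [Fin.forall_fin_two, hx, hy])
  let : DistribLattice D :=
    { Subtype.lattice hsup hinf with
      le_sup_inf := fun x y z => le_sup_inf (x := (x : Z → P)) (y := y) (z := z) }
  have : Finite D := by
    obtain ⟨s, hs, rfl⟩ := Substructure.fg_def.1 hD
    let T : latticeLang.Substructure (Z → P) := ⟨latticeClosure s, by
      rintro _ ⟨⟩ x hx
      · exact isSublattice_latticeClosure.infClosed (hx 0) (hx 1)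
      · exact isSublattice_latticeClosure.supClosed (hx 0) (hx 1)⟩
    have hle : Substructure.closure latticeLang s ≤ T :=
      Substructure.closure_le.2 subset_latticeClosure
    exact hs.latticeClosure.subset hle
  exact mem_finiteDistribLattices (fun x => rfl) fun x => rfl

/-- A lattice homomorphism as a homomorphism of first-order structures. -/
def latticeLangHom {A B : Type*} [Lattice A] [Lattice B] (f : LatticeHom A B) :
    letI := latticeStructure A
    letI := latticeStructure B
    A →[latticeLang] B :=
  letI := latticeStructure A
  letI := latticeStructure B
  { toFun := f
    map_fun' := by
      rintro _ ⟨⟩ x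
      · exact map_inf f (x 0) (x 1)
      · exact map_sup f (x 0) (x 1)
    map_rel' := fun r => r.elim }

theorem isInjectiveFor_finiteDistribLattices_prop :
    letI := latticeStructure Prop
    IsInjectiveFor latticeLang finiteDistribLattices Prop := by
  let := latticeStructure Prop
  intro A B hA hB e h
  induction A, hA using finiteDistribLattices_induction with | _ A
  induction B, hB using finiteDistribLattices_induction with | _ B
  let := latticeStructure A
  let := latticeStructure B
  let e' : LatticeHom A B :=
    ⟨⟨e, fun a a' => e.map_fun LatticeFunc.sup ![a, a']⟩,
      fun a a' => e.map_fun LatticeFunc.inf ![a, a']⟩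
  let h' : LatticeHom A Prop :=
    ⟨⟨h, fun a a' => h.map_fun LatticeFunc.sup ![a, a']⟩,
      fun a a' => h.map_fun LatticeFunc.inf ![a, a']⟩
  obtain ⟨g, hg⟩ := exists_latticeHom_prop_extending e' e.injective h'
  exact ⟨latticeLangHom g, hg⟩

theorem hasJointExtensions_latticeHom {P : Type u} [Countable P] [DistribLattice P]
    (hP : IsUniversalHomogeneousDistribLattice P) :
    Nontrivial (LatticeHom P P) ∧ HasJointExtensions (LatticeHom P P) := by
  let := latticeStructure P
  let := latticeStructure Prop
  have hP : IsFraisseLimit finiteDistribLattices P := hP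
  let := latticeStructure (ULift.{u} Bool)
  let : DistribLattice (ULift.{u} Bool) :=
    ULift.down_injective.distribLattice _ .rfl .rfl (fun _ _ => rfl) fun _ _ => rfl
  obtain ⟨i⟩ := exists_embedding_of_isFraisseLimit hP
    (D := bundledOf latticeLang (ULift.{u} Bool))
    (mem_finiteDistribLattices (fun x => rfl) fun x => rfl)
  have hi : i ⟨true⟩ ≠ i ⟨false⟩ := fun h => by cases i.injective h
  have : Nonempty P := ⟨i ⟨true⟩⟩
  let e : (P →[latticeLang] P) ≃ LatticeHom P P :=
    { toFun := fun f => ⟨⟨f, fun a b => f.map_fun LatticeFunc.sup ![a, b]⟩,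
        fun a b => f.map_fun LatticeFunc.inf ![a, b]⟩
      invFun := latticeLangHom
      left_inv := fun _ => rfl
      right_inv := fun _ => rfl }
  have hK := fg_mem_of_isFraisseLimit hP
  have ext := hasExtensions_of_isFraisseLimit hP
  refine ⟨⟨⟨⟨fun _ => i ⟨true⟩, fun _ _ => (sup_idem _).symm⟩, fun _ _ => (inf_idem _).symm⟩,
      ⟨⟨fun _ => i ⟨false⟩, fun _ _ => (sup_idem _).symm⟩, fun _ _ => (inf_idem _).symm⟩,
      fun h => hi (DFunLike.congr_fun h (i ⟨true⟩))⟩,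
    hasJointExtensions_of_equiv e (fun _ _ => rfl) (exists_joint_extensions
      (fun Z _ => powers_mem_finiteDistribLattices P Z) hK ext (isInjectiveFor_of_cogenerator Prop
        ?_ hK ext isInjectiveFor_finiteDistribLattices_prop
        (fun Z => powers_mem_finiteDistribLattices Prop Z) ?_ fun _ _ _ r => r.elim))⟩
  · intro A hA
    have := hA.1
    exact FG.of_finite
  · intro C hC
    induction C, hC using finiteDistribLattices_induction with | _ C
    intro x y hxy
    obtain ⟨φ, hφ⟩ := exists_latticeHom_prop_ne (B := C) hxy
    exact ⟨latticeLangHom φ, hφ⟩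

end DistribLattice

/-! ### Extension of embeddings into atomless Boolean algebras -/

section BooleanAlgebra

theorem exists_lt_of_atomless {A : Type u} [BooleanAlgebra A] (hA : ∀ a : A, ¬ IsAtom a) {a : A}
    (ha : a ≠ ⊥) : ∃ b, b ≠ ⊥ ∧ b < a := by
  by_contra! h
  exact hA a ⟨ha, fun b hb => by_contra fun hne => h b hne hb⟩

/-- In an atomless Boolean algebra, nonzero elements have partitions of any finite size. -/
theorem exists_partition_of_atomless {A : Type u} [BooleanAlgebra A] (hA : ∀ a : A, ¬ IsAtom a)
    {α : Type*} {s : Finset α} (hs : s.Nonempty) :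
    ∀ a : A, a ≠ ⊥ → ∃ q : α → A, (∀ x ∈ s, q x ≠ ⊥) ∧
      (∀ x ∈ s, ∀ y ∈ s, x ≠ y → Disjoint (q x) (q y)) ∧ s.sup q = a := by
  classical
  induction hs using Finset.Nonempty.cons_induction with
  | singleton x =>
    intro a ha
    refine ⟨fun _ => a, fun _ _ => ha, fun y hy z hz hyz => ?_, by simp⟩
    rw [Finset.mem_singleton] at hy hz
    exact absurd (hy.trans hz.symm) hyz
  | cons x s hx hs ih =>
    intro a ha
    obtain ⟨b, hb, hba⟩ := exists_lt_of_atomless hA ha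
    obtain ⟨q, hq, hdis, hsup⟩ := ih (a \ b) fun h => not_le_of_gt hba (sdiff_eq_bot_iff.1 h)
    have hne : ∀ y ∈ s, y ≠ x := fun y hy hyx => hx (hyx ▸ hy)
    have hle : ∀ y ∈ s, q y ≤ a \ b := fun y hy => hsup ▸ Finset.le_sup hy
    have hupd : ∀ y ∈ s, Function.update q x b y = q y := fun y hy =>
      Function.update_of_ne (hne y hy) _ _
    have hbq : ∀ y ∈ s, Disjoint b (q y) := fun y hy =>
      disjoint_sdiff_self_right.mono_right (hle y hy)
    refine ⟨Function.update q x b, ?_, ?_, ?_⟩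
    · intro y hy
      rcases Finset.mem_cons.1 hy with rfl | hy
      · simpa using hb
      · rw [hupd y hy]
        exact hq y hy
    · intro y hy z hz hyz
      rcases Finset.mem_cons.1 hy with rfl | hy' <;> rcases Finset.mem_cons.1 hz with rfl | hz'
      · exact absurd rfl hyz
      · rw [hupd z hz', Function.update_self]
        exact hbq z hz'
      · rw [hupd y hy', Function.update_self]
        exact (hbq y hy').symm
      · rw [hupd y hy', hupd z hz']
        exact hdis y hy' z hz' hyz
    · rw [Finset.sup_cons, Function.update_self, Finset.sup_congr rfl hupd, hsup]
      exact sup_sdiff_cancel_right hba.le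

/-- Finite Boolean algebras embed in an atomless one over any common subalgebra. -/
theorem exists_extension_of_atomless {A W D : Type*} [BooleanAlgebra A] [BooleanAlgebra W]
    [BooleanAlgebra D] [Finite D] (hA : ∀ a : A, ¬ IsAtom a) (i : BoundedLatticeHom W A)
    (hi : Function.Injective i) (e : BoundedLatticeHom W D) (he : Function.Injective e) :
    ∃ f : BoundedLatticeHom D A, Function.Injective f ∧ ∀ w, f (e w) = i w := by
  classical
  have := Finite.of_injective e he
  have := Fintype.ofFinite D
  have := Fintype.ofFinite W
  let at' : D → Finset D := fun d => Finset.univ.filter fun δ => IsAtom δ ∧ δ ≤ d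
  have mem_at : ∀ d δ, δ ∈ at' d ↔ IsAtom δ ∧ δ ≤ d := fun d δ => by simp [at']
  have atom_le : ∀ {δ a b : D}, IsAtom δ → δ ≤ a ⊔ b → δ ≤ a ∨ δ ≤ b := by
    intro δ a b hδ h
    rw [← hδ.not_disjoint_iff_le] at h ⊢
    rw [← hδ.not_disjoint_iff_le]
    rw [disjoint_sup_right] at h
    tauto
  have hW : (Finset.univ.filter fun w : W => IsAtom w).sup id = ⊤ := by
    by_contra hne
    rw [← compl_eq_bot] at hne
    obtain ⟨v, hv, hle⟩ := (eq_bot_or_exists_atom_le _).resolve_left hne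
    refine hv.1 (disjoint_self.1 (disjoint_compl_right.mono ?_ hle))
    exact Finset.le_sup (f := id) (by simpa using hv)
  have ebot : ∀ v, v ≠ ⊥ → e v ≠ ⊥ := fun v hv h => hv (he (h.trans (map_bot e).symm))
  have at_nonempty : ∀ d, d ≠ ⊥ → (at' d).Nonempty := by
    intro d hd
    obtain ⟨δ, hδ, hle⟩ := (eq_bot_or_exists_atom_le d).resolve_left hd
    exact ⟨δ, (mem_at d δ).2 ⟨hδ, hle⟩⟩
  -- An atom v of W splits in D into the atoms below `e v`; its image `i v` is split in A into
  -- pieces indexed by those atoms.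
  have hq : ∀ v : W, IsAtom v → ∃ q : D → A, (∀ x ∈ at' (e v), q x ≠ ⊥) ∧
      (∀ x ∈ at' (e v), ∀ y ∈ at' (e v), x ≠ y → Disjoint (q x) (q y)) ∧
      (at' (e v)).sup q = i v := fun v hv =>
    exists_partition_of_atomless hA (at_nonempty _ (ebot v hv.1)) (i v)
      fun h => hv.1 (hi (h.trans (map_bot i).symm))
  choose! q hq_ne hq_dis hq_sup using hq
  have hcell : ∀ δ : D, IsAtom δ → ∃ v : W, IsAtom v ∧ δ ≤ e v := by
    intro δ hδ
    have h : ¬ Disjoint δ ((Finset.univ.filter fun w : W => IsAtom w).sup e) := by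
      rw [hδ.not_disjoint_iff_le]
      have := map_finset_sup e (Finset.univ.filter fun w : W => IsAtom w) id
      rw [hW, map_top] at this
      exact (le_top (a := δ)).trans this.le
    rw [Finset.disjoint_sup_right] at h
    push Not at h
    obtain ⟨v, hv, hd⟩ := h
    exact ⟨v, by simpa using hv, hδ.not_disjoint_iff_le.1 hd⟩
  choose! v hv_atom hv_le using hcell
  have hv_eq : ∀ δ w, IsAtom δ → IsAtom w → δ ≤ e w → v δ = w := by
    intro δ w hδ hw hle
    by_contra hne
    have hdis := ((hv_atom δ hδ).disjoint_of_ne hw hne).map e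
    exact hδ.1 (disjoint_self.1 (hdis.mono (hv_le δ hδ) hle))
  -- Each atom δ of D lies in exactly one cell `v δ` and receives its piece there; d will be sent to
  -- the join of the pieces of the atoms below it.
  let p : D → A := fun δ => q (v δ) δ
  have hmem : ∀ δ, IsAtom δ → δ ∈ at' (e (v δ)) := fun δ hδ => (mem_at _ _).2 ⟨hδ, hv_le δ hδ⟩
  have hp_ne : ∀ δ, IsAtom δ → p δ ≠ ⊥ := fun δ hδ => hq_ne _ (hv_atom δ hδ) δ (hmem δ hδ)
  have hp_le : ∀ δ, IsAtom δ → p δ ≤ i (v δ) := fun δ hδ =>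
    hq_sup _ (hv_atom δ hδ) ▸ Finset.le_sup (f := q (v δ)) (hmem δ hδ)
  have hp_dis : ∀ δ δ', IsAtom δ → IsAtom δ' → δ ≠ δ' → Disjoint (p δ) (p δ') := by
    intro δ δ' hδ hδ' hne
    by_cases hv : v δ = v δ'
    · have h := hq_dis _ (hv_atom δ hδ) δ (hmem δ hδ) δ' (hv ▸ hmem δ' hδ') hne
      change Disjoint (q (v δ) δ) (q (v δ') δ')
      rwa [← hv]
    · exact (((hv_atom δ hδ).disjoint_of_ne (hv_atom δ' hδ') hv).map i).mono
        (hp_le δ hδ) (hp_le δ' hδ')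
  let f₀ : SupBotHom D A :=
    { toFun := fun d => (at' d).sup p
      map_sup' := by
        intro a b
        rw [← Finset.sup_union]
        congr 1
        ext δ
        simp only [Finset.mem_union, mem_at]
        refine ⟨fun ⟨hδ, h⟩ => (atom_le hδ h).imp (⟨hδ, ·⟩) (⟨hδ, ·⟩), ?_⟩
        rintro (⟨hδ, h⟩ | ⟨hδ, h⟩)
        · exact ⟨hδ, h.trans le_sup_left⟩
        · exact ⟨hδ, h.trans le_sup_right⟩
      map_bot' := by
        have : at' ⊥ = ∅ := by
          ext δ
          rw [mem_at]
          simpa using fun h : IsAtom δ => h.1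
        change (at' ⊥).sup p = ⊥
        rw [this, Finset.sup_empty] }
  have hf₀_atom : ∀ w, IsAtom w → f₀ (e w) = i w := by
    intro w hw
    rw [← hq_sup w hw]
    refine Finset.sup_congr rfl fun δ hδ => ?_
    obtain ⟨hδ, hle⟩ := (mem_at _ _).1 hδ
    change q (v δ) δ = q w δ
    rw [hv_eq δ w hδ hw hle]
  have hf₀ : ∀ w, f₀ (e w) = i w := by
    intro w
    have hw : ((Finset.univ.filter fun u : W => IsAtom u).filter (· ≤ w)).sup id = w := by
      refine le_antisymm (Finset.sup_le fun u hu => (Finset.mem_filter.1 hu).2) ?_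
      by_contra hne
      rw [← sdiff_eq_bot_iff] at hne
      obtain ⟨u, hu, hle⟩ := (eq_bot_or_exists_atom_le _).resolve_left hne
      refine hu.1 (disjoint_self.1 (disjoint_sdiff_self_right.mono ?_ hle))
      exact Finset.le_sup (f := id) (by simpa using ⟨hu, hle.trans sdiff_le⟩)
    rw [← hw, map_finset_sup, map_finset_sup, map_finset_sup]
    refine Finset.sup_congr rfl fun u hu => hf₀_atom u ?_
    simp only [Finset.mem_filter, Finset.mem_univ, true_and] at hu
    exact hu.1
  let f : BoundedLatticeHom D A :=
    { toFun := f₀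
      map_sup' := map_sup f₀
      map_bot' := map_bot f₀
      map_top' := by
        have := hf₀ ⊤
        rwa [map_top e, map_top i] at this
      map_inf' := by
        intro a b
        refine le_antisymm (le_inf (OrderHomClass.mono f₀ inf_le_left)
          (OrderHomClass.mono f₀ inf_le_right)) ?_
        change (at' a).sup p ⊓ (at' b).sup p ≤ (at' (a ⊓ b)).sup p
        rw [Finset.sup_inf_sup]
        refine Finset.sup_le fun ⟨δ, δ'⟩ hδ => ?_
        rw [Finset.mem_product, mem_at, mem_at] at hδ
        obtain ⟨⟨hδ, hle⟩, hδ', hle'⟩ := hδ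
        by_cases h : δ = δ'
        · refine inf_le_left.trans (Finset.le_sup (f := p) ((mem_at _ _).2 ⟨hδ, le_inf hle ?_⟩))
          exact h.le.trans hle'
        · exact (hp_dis δ δ' hδ hδ' h).le_bot.trans bot_le }
  -- A nonzero d contains an atom, whose piece is nonzero; a trivial kernel yields injectivity
  -- through differences.
  have hker : ∀ d, f d = ⊥ → d = ⊥ := by
    intro d hd
    by_contra hne
    obtain ⟨δ, hδ⟩ := at_nonempty d hne
    exact hp_ne δ ((mem_at _ _).1 hδ).1 (le_bot_iff.1 ((Finset.le_sup (f := p) hδ).trans hd.le))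
  have hle : ∀ a b, f a ≤ f b → a ≤ b := by
    intro a b hab
    rw [← sdiff_eq_bot_iff]
    refine hker _ ?_
    rw [map_sdiff', sdiff_eq_bot_iff]
    exact hab
  exact ⟨f, fun a b hab => le_antisymm (hle a b hab.le) (hle b a hab.ge), hf₀⟩

end BooleanAlgebra

/-! ### The countable atomless Boolean algebra -/

section BooleanLanguage

/-- The function symbols of the signature of Boolean algebras. -/
inductive BooleanFunc : ℕ → Type
  | inf : BooleanFunc 2
  | sup : BooleanFunc 2
  | compl : BooleanFunc 1
  | bot : BooleanFunc 0

/-- The signature of Boolean algebras. -/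
def booleanLang : FirstOrder.Language.{0, 0} := ⟨BooleanFunc, fun _ => Empty⟩

/-- A Boolean algebra as a first-order structure. -/
@[reducible] def booleanStructure (A : Type*) [BooleanAlgebra A] : booleanLang.Structure A where
  funMap
    | .inf => fun x => x 0 ⊓ x 1
    | .sup => fun x => x 0 ⊔ x 1
    | .compl => fun x => (x 0)ᶜ
    | .bot => fun _ => ⊥
  RelMap r := r.elim

/-- The class of all finite Boolean algebras. -/
def finiteBooleanAlgebras : Set (Bundled.{u} booleanLang.Structure) :=
  {N | Finite N ∧ ∃ _ : BooleanAlgebra N, N.str = booleanStructure N}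

theorem finiteBooleanAlgebras_induction {p : ∀ A, A ∈ finiteBooleanAlgebras.{u} → Prop}
    (h : ∀ (A : Type u) [BooleanAlgebra A] [Finite A],
      p ⟨A, booleanStructure A⟩ ⟨inferInstanceAs (Finite A), inferInstance, rfl⟩) (A)
    (hA : A ∈ finiteBooleanAlgebras) : p A hA := by
  have aux : ∀ (A : Type u) (S : booleanLang.Structure A) [BooleanAlgebra A]
      (_ : S = booleanStructure A) [Finite A] (hA : ⟨A, S⟩ ∈ finiteBooleanAlgebras),
      p ⟨A, S⟩ hA := by
    rintro A _ _ rfl _ hA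
    exact h A
  have := hA.1
  obtain ⟨_, P, hP⟩ := id hA
  exact aux A.1 A.2 hP hA

/-- A substructure of a Boolean algebra as a Boolean subalgebra. -/
def booleanSubalgebraOfSubstructure {T : Type*} [BooleanAlgebra T] [S : booleanLang.Structure T]
    (hS : S = booleanStructure T) (D : booleanLang.Substructure T) : BooleanSubalgebra T where
  carrier := D
  supClosed' := by
    subst hS
    let := booleanStructure T
    exact fun x hx y hy => D.fun_mem BooleanFunc.sup ![x, y]
      (by simpa [Fin.forall_fin_two] using ⟨hx, hy⟩)
  infClosed' := by
    subst hS
    let := booleanStructure T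
    exact fun x hx y hy => D.fun_mem BooleanFunc.inf ![x, y]
      (by simpa [Fin.forall_fin_two] using ⟨hx, hy⟩)
  compl_mem' := by
    subst hS
    let := booleanStructure T
    exact fun {x} hx => D.fun_mem BooleanFunc.compl ![x] (by simpa using hx)
  bot_mem' := by
    subst hS
    let := booleanStructure T
    exact D.fun_mem BooleanFunc.bot ![] (by simp)

theorem compl_mem_latticeClosure {T : Type*} [BooleanAlgebra T] {s : Set T}
    (hs : ∀ x ∈ s, xᶜ ∈ s) {x : T} (hx : x ∈ latticeClosure s) : xᶜ ∈ latticeClosure s := by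
  induction hx using latticeClosure_sup_inf_induction with
  | mem a ha => exact subset_latticeClosure (hs a ha)
  | sup a _ b _ ha hb => exact compl_sup (a := a) ▸ isSublattice_latticeClosure.infClosed ha hb
  | inf a _ b _ ha hb => exact compl_inf (x := a) ▸ isSublattice_latticeClosure.supClosed ha hb

theorem fg_mem_finiteBooleanAlgebras {T : Type u} [BooleanAlgebra T] [S : booleanLang.Structure T]
    (hS : S = booleanStructure T) (D : booleanLang.Substructure T) (hD : D.FG) :
    bundledOf booleanLang D ∈ finiteBooleanAlgebras := by
  let : BooleanAlgebra D := inferInstanceAs (BooleanAlgebra (booleanSubalgebraOfSubstructure hS D))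
  refine ⟨?_, this, ?_⟩
  · obtain ⟨s, hs, rfl⟩ := Substructure.fg_def.1 hD
    let t : Set T := s ∪ compl '' s ∪ {⊥, ⊤}
    have ht : ∀ x ∈ t, xᶜ ∈ t := by
      rintro x ((hx | ⟨x, hx, rfl⟩) | (rfl | rfl))
      · exact .inl (.inr ⟨x, hx, rfl⟩)
      · exact .inl (.inl ((compl_compl x).symm ▸ hx))
      · simp [t]
      · simp [t]
    have htfin : t.Finite := (hs.union (hs.image _)).union (by simp)
    let U : booleanLang.Substructure T := ⟨latticeClosure t, by
      subst hS
      rintro _ ⟨⟩ x hx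
      · exact isSublattice_latticeClosure.infClosed (hx 0) (hx 1)
      · exact isSublattice_latticeClosure.supClosed (hx 0) (hx 1)
      · exact compl_mem_latticeClosure ht (hx 0)
      · exact subset_latticeClosure (.inr (.inl rfl))⟩
    have hle : Substructure.closure booleanLang s ≤ U :=
      Substructure.closure_le.2 fun x hx => subset_latticeClosure (.inl (.inl hx))
    exact htfin.latticeClosure.subset hle
  · subst hS
    ext n φ x
    · cases φ <;> rfl
    · exact φ.elim

/-- The componentwise structure on a power is identified symbol by symbol with that of the product
algebra; this is why the preceding results take an equation `hS` of structures. -/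
theorem pi_booleanStructure (P Z : Type*) [BooleanAlgebra P] :
    letI := booleanStructure P
    (instStructurePi : booleanLang.Structure (Z → P)) = booleanStructure (Z → P) := by
  ext n φ x
  · cases φ <;> rfl
  · exact φ.elim

/-- Homomorphisms of Boolean algebras are homomorphisms of first-order structures. -/
def booleanHomEquiv (A B : Type*) [BooleanAlgebra A] [BooleanAlgebra B] :
    letI := booleanStructure A
    letI := booleanStructure B
    (A →[booleanLang] B) ≃ BoundedLatticeHom A B :=
  letI := booleanStructure A
  letI := booleanStructure B
  { toFun := fun f =>
      have hbot : f ⊥ = ⊥ := f.map_fun BooleanFunc.bot ![]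
      { toFun := f
        map_sup' := fun a b => f.map_fun BooleanFunc.sup ![a, b]
        map_inf' := fun a b => f.map_fun BooleanFunc.inf ![a, b]
        map_bot' := hbot
        map_top' := by
          have : f ⊥ᶜ = (f ⊥)ᶜ := f.map_fun BooleanFunc.compl ![⊥]
          rwa [hbot, compl_bot, compl_bot] at this }
    invFun := fun f =>
      { toFun := f
        map_fun' := by
          rintro _ ⟨⟩ x
          · exact map_inf f (x 0) (x 1)
          · exact map_sup f (x 0) (x 1)
          · exact map_compl' f (x 0)
          · exact map_bot f
        map_rel' := fun r => r.elim }
    left_inv := fun _ => rfl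
    right_inv := fun _ => rfl }

theorem isInjectiveFor_finiteBooleanAlgebras_prop :
    letI := booleanStructure Prop
    IsInjectiveFor booleanLang finiteBooleanAlgebras Prop := by
  let := booleanStructure Prop
  intro A B hA hB e h
  induction A, hA using finiteBooleanAlgebras_induction with | _ A
  induction B, hB using finiteBooleanAlgebras_induction with | _ B
  let := booleanStructure A
  let := booleanStructure B
  let e' : BoundedLatticeHom A B := booleanHomEquiv A B e.toHom
  let h' : BoundedLatticeHom A Prop := booleanHomEquiv A Prop h
  obtain ⟨g, hg⟩ := exists_latticeHom_prop_extending e'.toLatticeHom e.injective h'.toLatticeHom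
  let g' : BoundedLatticeHom B Prop :=
    { g with
      map_top' := by
        have h1 := hg ⊤
        rw [show e'.toLatticeHom ⊤ = ⊤ from map_top e',
          show h'.toLatticeHom ⊤ = ⊤ from map_top h'] at h1
        exact h1
      map_bot' := by
        have h1 := hg ⊥
        rw [show e'.toLatticeHom ⊥ = ⊥ from map_bot e',
          show h'.toLatticeHom ⊥ = ⊥ from map_bot h'] at h1
        exact h1 }
  exact ⟨(booleanHomEquiv B Prop).symm g', hg⟩

/-- A lattice homomorphism to `Prop` that separates two points is not constant, so by monotonicity
it preserves both bounds. -/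
theorem exists_boundedLatticeHom_prop_ne {B : Type*} [DistribLattice B] [BoundedOrder B] {x y : B}
    (h : x ≠ y) : ∃ φ : BoundedLatticeHom B Prop, φ x ≠ φ y := by
  obtain ⟨φ, hφ⟩ := exists_latticeHom_prop_ne h
  have mono : ∀ {a b}, a ≤ b → φ a → φ b := fun hab => OrderHomClass.mono φ hab
  refine ⟨{ φ with
    map_top' := propext (iff_true_right trivial |>.2 (by_contra fun ht => hφ ?_))
    map_bot' := propext (iff_false_right id |>.2 fun hb => hφ ?_) }, hφ⟩
  · exact propext ⟨fun hx => absurd (mono le_top hx) ht, fun hx => absurd (mono le_top hx) ht⟩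
  · exact propext ⟨fun _ => mono bot_le hb, fun _ => mono bot_le hb⟩

theorem hasExtensions_of_atomless {A : Type u} [BooleanAlgebra A] (hA : ∀ a : A, ¬ IsAtom a) :
    letI := booleanStructure A
    HasExtensions booleanLang finiteBooleanAlgebras A := by
  let := booleanStructure A
  intro W hW D hD e
  induction D, hD using finiteBooleanAlgebras_induction with | _ D
  let := booleanStructure D
  let V := booleanSubalgebraOfSubstructure rfl W
  let e' : BoundedLatticeHom V D :=
    have hbot : e ⟨⊥, V.bot_mem⟩ = (⊥ : D) := e.map_fun BooleanFunc.bot ![]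
    { toFun := e
      map_sup' := fun a b => e.map_fun BooleanFunc.sup ![a, b]
      map_inf' := fun a b => e.map_fun BooleanFunc.inf ![a, b]
      map_bot' := hbot
      map_top' := by
        have h : e (⊥ᶜ : V) = (e (⊥ : V))ᶜ := e.map_fun BooleanFunc.compl ![(⊥ : V)]
        have h' : e (⊥ : V) = (⊥ : D) := hbot
        rwa [h', compl_bot, compl_bot] at h }
  let i : BoundedLatticeHom V A := V.subtype
  obtain ⟨f, hf, hfe⟩ := exists_extension_of_atomless hA i Subtype.val_injective e' e.injective
  let f' : D →[booleanLang] A := (booleanHomEquiv D A).symm f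
  exact ⟨⟨⟨f', hf⟩, f'.map_fun, fun r => r.elim⟩, hfe⟩

theorem nontrivial_boundedLatticeHom_of_atomless {A : Type u} [BooleanAlgebra A]
    (hA : IsAtomlessBooleanAlgebra A) : Nontrivial (BoundedLatticeHom A A) := by
  classical
  have := hA.1
  obtain ⟨φ, -⟩ := exists_boundedLatticeHom_prop_ne (bot_ne_top (α := A))
  obtain ⟨a, ha, hlt⟩ := exists_lt_of_atomless hA.2 (top_ne_bot (α := A))
  have hinf : ∀ x y, φ (x ⊓ y) ↔ φ x ∧ φ y := fun x y => iff_of_eq (map_inf φ x y)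
  have hsup : ∀ x y, φ (x ⊔ y) ↔ φ x ∨ φ y := fun x y => iff_of_eq (map_sup φ x y)
  have htop : φ ⊤ := (map_top φ).symm ▸ trivial
  have hbot : ¬ φ ⊥ := fun h => (map_bot φ ▸ h : (⊥ : Prop))
  -- This retraction onto {⊥, ⊤} given by a prime filter differs from the identity at any element
  -- strictly between the bounds.
  let ψ : BoundedLatticeHom A A :=
    { toFun := fun x => if φ x then ⊤ else ⊥
      map_sup' := fun x y => by
        by_cases hx : φ x <;> by_cases hy : φ y <;> simp [hx, hy, hsup]
      map_inf' := fun x y => by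
        by_cases hx : φ x <;> by_cases hy : φ y <;> simp [hx, hy, hinf]
      map_top' := if_pos htop
      map_bot' := if_neg hbot }
  refine ⟨ψ, BoundedLatticeHom.id A, fun h => ?_⟩
  have h : (if φ a then ⊤ else ⊥) = a := DFunLike.congr_fun h a
  split_ifs at h
  · exact hlt.ne h.symm
  · exact ha h.symm

theorem hasJointExtensions_boundedLatticeHom {A : Type u} [Countable A] [BooleanAlgebra A]
    (hA : IsAtomlessBooleanAlgebra A) : HasJointExtensions (BoundedLatticeHom A A) := by
  let := booleanStructure A
  let := booleanStructure Prop
  have hK : ∀ W : booleanLang.Substructure A, W.FG → _ := fg_mem_finiteBooleanAlgebras rfl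
  have ext := hasExtensions_of_atomless hA.2
  refine hasJointExtensions_of_equiv (booleanHomEquiv A A) (fun _ _ => rfl)
    (exists_joint_extensions
      (fun Z _ => fg_mem_finiteBooleanAlgebras (pi_booleanStructure A Z)) hK ext
      (isInjectiveFor_of_cogenerator Prop ?_ hK ext isInjectiveFor_finiteBooleanAlgebras_prop
        (fun Z => fg_mem_finiteBooleanAlgebras (pi_booleanStructure Prop Z)) ?_
        fun _ _ _ r => r.elim))
  · intro A hA
    have := hA.1
    exact FG.of_finite
  · intro C hC
    induction C, hC using finiteBooleanAlgebras_induction with | _ C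
    intro x y hxy
    obtain ⟨φ, hφ⟩ := exists_boundedLatticeHom_prop_ne (B := C) hxy
    exact ⟨(booleanHomEquiv C Prop).symm φ, hφ⟩

end BooleanLanguage

end BergmanEnd

/-! ### The six structures -/

theorem corollary4p4 :
    -- the random graph
    (∀ (R : Type*) [Countable R] (G : SimpleGraph R), BergmanEnd.IsRandomGraph G →
      BergmanEnd.HasBergmanProperty (G →g G) ∧
        BergmanEnd.Divides (Function.End ℕ) (G →g G)) ∧
    -- the generic poset
    (∀ (P : Type*) [Countable P] [PartialOrder P], BergmanEnd.IsGenericPoset P →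
      BergmanEnd.HasBergmanProperty (P →o P) ∧
        BergmanEnd.Divides (Function.End ℕ) (P →o P)) ∧
    -- the universal homogeneous semilattice
    (∀ (S : Type*) [Countable S] [SemilatticeInf S],
      BergmanEnd.IsUniversalHomogeneousSemilattice S →
      BergmanEnd.HasBergmanProperty (InfHom S S) ∧
        BergmanEnd.Divides (Function.End ℕ) (InfHom S S)) ∧
    -- the universal homogeneous distributive lattice
    (∀ (D : Type*) [Countable D] [DistribLattice D],
      BergmanEnd.IsUniversalHomogeneousDistribLattice D →
      BergmanEnd.HasBergmanProperty (LatticeHom D D) ∧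
        BergmanEnd.Divides (Function.End ℕ) (LatticeHom D D)) ∧
    -- the countable atomless Boolean algebra
    (∀ (A : Type*) [Countable A] [BooleanAlgebra A], BergmanEnd.IsAtomlessBooleanAlgebra A →
      BergmanEnd.HasBergmanProperty (BoundedLatticeHom A A) ∧
        BergmanEnd.Divides (Function.End ℕ) (BoundedLatticeHom A A)) ∧
    -- the vector space of dimension ℵ₀ over a field
    (∀ (F V : Type*) [Field F] [AddCommGroup V] [Module F V],
      Module.rank F V = Cardinal.aleph0 →
      BergmanEnd.HasBergmanProperty (Module.End F V) ∧
        BergmanEnd.Divides (Function.End ℕ) (Module.End F V)) := by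
  refine ⟨fun R _ G h => ?_, fun P _ _ h => ?_, fun S _ _ h => ?_, fun D _ _ h => ?_,
    fun A _ _ h => ?_, fun F V _ _ _ h => ?_⟩
  · have ⟨_, hj⟩ := BergmanEnd.hasJointExtensions_graph h
    exact BergmanEnd.bergman_and_divides hj
  · have ⟨_, hj⟩ := BergmanEnd.hasJointExtensions_orderHom h
    exact BergmanEnd.bergman_and_divides hj
  · have ⟨_, hj⟩ := BergmanEnd.hasJointExtensions_infHom h
    exact BergmanEnd.bergman_and_divides hj
  · have ⟨_, hj⟩ := BergmanEnd.hasJointExtensions_latticeHom h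
    exact BergmanEnd.bergman_and_divides hj
  · have := BergmanEnd.nontrivial_boundedLatticeHom_of_atomless h
    exact BergmanEnd.bergman_and_divides (BergmanEnd.hasJointExtensions_boundedLatticeHom h)
  · have := BergmanEnd.nontrivial_moduleEnd h
    exact BergmanEnd.bergman_and_divides (BergmanEnd.hasJointExtensions_moduleEnd h)
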